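/- **Setting.** Identify the circle $\mathbb T^1=\mathbb R/\mathbb Z$ with $[0,1)$ and let $m$ be Lebesgue measure on it. Let $0<\alpha\le 1$, $f:[0,1)\to[0,1)$ and $\tau:[0,1)\to\mathbb R$. Let $\{O_i\}_{i\in I}$ be a countable family of pairwise disjoint nonempty open intervals in $[0,1]$ that covers $[0,1)$ up to a countable set (the joint partition of $f$ and $\tau$), such that on each $O_i$ the map $f$ is strictly monotone and $C^1$ with $\alpha$-Hölder derivative (hence $C^{1+\alpha}$ up to the closure of $O_i$), and $\tau$ is $C^1$. For $n\ge1$ let $\mathcal H^n$ be the set of inverse branches $h:f^n(O_h)\to O_h$ of $f^n$, where $O_h$ runs over the nonempty sets $\{x: f^k(x)\in O_{i_k},\ 0\le k<n\}$, and let $\tau_n=\sum_{j=0}^{n-1}\tau\circ f^j$. Assume: 1. (expansion) there is $\lambda>\ln 2$ with $|(f^n)'|\ge e^{\lambda n}$ on every $O_h$, $h\in\mathcal H^n$, $n\ge1$; 2. (distortion) there is $D\ge0$ with $|h'(x)|/|h'(y)|\le e^{D|x-y|^\alpha}$ for all $n\ge1$, $h\in\mathcal H^n$, $x,y\in f^n(O_h)$;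 3. (summability) $\sum_{h\in\mathcal H^n}\sup_{f^n(O_h)}|h'|<\infty$ for every $n\ge1$; 4. (covering) for every $n\ge1$ there is $N$ such that for every $h\in\mathcal H^n$ the set $f^N(O_h)$ is all of $[0,1)$ up to a countable set; 5. ($\tau$ is not Lipschitz-cohomologous to a piecewise constant function) there is no Lipschitz function $\phi:[0,1)\to\mathbb R$ for which $\tau-\phi\circ f+\phi$ is constant on each $O_i$; 6. there is $C_\tau$ with $|(\tau_n\circ h)'|\le C_\tau$ on $f^n(O_h)$ for all $n\ge1$, $h\in\mathcal H^n$. For $b\in\mathbb R$ let $$\mathcal L_b g=\sum_{h\in\mathcal H^1}e^{ib\,\tau\circ h}\; g\circ h\;|h'|\;\mathbf 1_{f(O_h)} .$$ Let $C^\alpha=C^\alpha(\mathbb T^1)$ be the space of complex $\alpha$-Hölder functions on the circle $\mathbb R/\mathbb Z$ with norm $\|g\|_{C^\alpha}=|g|_\alpha+\sup|g|$. Let $\mathcal B\subset L^1(m)$ be a complex Banach space with $\|g\|_{L^1}\le\|g\|_{\mathcal B}$ for $g\in\mathcal B$; with $C^\alpha\subset\mathcal B$ and $\|g\|_{\mathcal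 B}\le\|g\|_{C^\alpha}$ for $g\in C^\alpha$; and such that for every $g\in\mathcal B$ and $\varepsilon>0$ there is $g_\varepsilon\in C^\alpha$ with $\|g-g_\varepsilon\|_{L^1}\le\varepsilon\|g\|_{\mathcal B}$ and $\|g_\varepsilon\|_{C^\alpha}\le\varepsilon^{-(1+\alpha^{-1})}\|g\|_{\mathcal B}$. Assume finally that $f$ preserves a probability measure $\mu\ll m$ whose density belongs to $\mathcal B$ and that $(f,\mu)$ is mixing. **Proposition.** Let $b\in\mathbb R$, $b\ne0$, be such that $\mathcal L_b$ is a bounded operator $\mathcal B\to\mathcal B$ with spectral radius $\le1$ and essential spectral radius $<1$ (the latter being the least $r\ge 0$ such that every point of the spectrum of modulus $>r$ is an isolated eigenvalue of finite algebraic multiplicity). Then there are constants $C$ and $r>0$, both depending on $b$, such that for every $n\in\mathbb N$ $$\|\mathcal L_b^n\|_{\mathcal B}\le C e^{-rn}.$$ In particular this holds for every $b\neq 0$ if $\mathcal L_b$ has these properties for every $b$. -/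

import Mathlib

open MeasureTheory Set Filter Topology
open scoped NNReal ENNReal

noncomputable section

namespace SkewProduct

/-! ### Essential spectral radius of a bounded operator -/

section EssentialSpectrum

variable {E : Type*} [NormedAddCommGroup E] [NormedSpace ℂ E]

/-- A Browder operator: a Fredholm operator with finite ascent and finite descent. For `z` in the
spectrum of `T`, the operator `z - T` is Browder exactly when `z` is an isolated point of the
spectrum and an eigenvalue of finite algebraic multiplicity (finite rank Riesz projection). -/
structure IsBrowder (T : E →L[ℂ] E) : Prop where
  isFredholm : T.IsFredholm
  finite_ascent : ∃ k : ℕ, (T ^ k).ker = (T ^ (k + 1)).ker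
  finite_descent : ∃ k : ℕ, (T ^ k).range = (T ^ (k + 1)).range

/-- The (Browder) essential spectrum: the spectrum without the isolated eigenvalues of finite
algebraic multiplicity. -/
def essentialSpectrum (T : E →L[ℂ] E) : Set ℂ :=
  {z | ¬ IsBrowder (z • (1 : E →L[ℂ] E) - T)}

/-- The essential spectral radius: the least `r` such that the spectrum outside the closed disc of
radius `r` consists of isolated eigenvalues of finite algebraic multiplicity. -/
def essentialSpectralRadius (T : E →L[ℂ] E) : ℝ≥0∞ :=
  ⨆ z ∈ essentialSpectrum T, (‖z‖₊ : ℝ≥0∞)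

end EssentialSpectrum

/-! ### The dynamical setting

The circle is `[0, 1)`. The base map `f` and the fibre function `τ` are given by real functions of
which only the values on `[0, 1)` matter. The family `O` lists the open intervals of the
(joint) partition of `f` and `τ`. -/

variable {ι : Type*}

/-- The partition element of `f^n` that belongs to the itinerary `w`. The nonempty ones are the
intervals `O_h` with `h` an inverse branch of `f^n`. -/
def cylinder (f : ℝ → ℝ) (O : ι → Set ℝ) {n : ℕ} (w : Fin n → ι) : Set ℝ :=
  {x | ∀ k : Fin n, f^[(k : ℕ)] x ∈ O (w k)}

/-- The image `f^n(O_h)`, which is the domain of the inverse branch `h` of `f^n`. -/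
def branchDomain (f : ℝ → ℝ) (O : ι → Set ℝ) {n : ℕ} (w : Fin n → ι) : Set ℝ :=
  f^[n] '' cylinder f O w

/-- The inverse branch `h : f^n(O_h) → O_h` of `f^n`. -/
def inverseBranch (f : ℝ → ℝ) (O : ι → Set ℝ) {n : ℕ} (w : Fin n → ι) : ℝ → ℝ :=
  Function.invFunOn f^[n] (cylinder f O w)

/-- The standing assumptions on the skew product `(x, y) ↦ (f x, y + τ x)`. -/
structure IsExpandingSkewProduct (α : ℝ≥0) (f τ : ℝ → ℝ) (O : ι → Set ℝ) : Prop where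
  mapsTo : MapsTo f (Ico 0 1) (Ico 0 1)
  -- a partition into open intervals, modulo a countable set
  interval : ∀ i, ∃ a c : ℝ, 0 ≤ a ∧ a < c ∧ c ≤ 1 ∧ O i = Ioo a c
  disjoint : Pairwise fun i j => Disjoint (O i) (O j)
  cover : (Ico (0 : ℝ) 1 \ ⋃ i, O i).Countable
  -- `f` is monotone and `C^{1+α}` on each interval, up to its closure
  monotone : ∀ i, StrictMonoOn f (O i) ∨ StrictAntiOn f (O i)
  contDiffOn : ∀ i, ContDiffOn ℝ 1 f (O i)
  holder_deriv : ∀ i, ∃ K : ℝ≥0, HolderOnWith K α (deriv f) (O i)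
  expanding : ∃ lam : ℝ, Real.log 2 < lam ∧ ∀ n : ℕ, 1 ≤ n → ∀ w : Fin n → ι,
    ∀ x ∈ cylinder f O w, Real.exp (lam * n) ≤ |deriv f^[n] x|
  distortion : ∃ D : ℝ, 0 ≤ D ∧ ∀ n : ℕ, 1 ≤ n → ∀ w : Fin n → ι,
    ∀ x ∈ branchDomain f O w, ∀ y ∈ branchDomain f O w,
      |deriv (inverseBranch f O w) x| / |deriv (inverseBranch f O w) y|
        ≤ Real.exp (D * |x - y| ^ (α : ℝ))
  summability : ∀ n : ℕ, 1 ≤ n →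
    ∑' w : Fin n → ι, ⨆ x ∈ branchDomain f O w, ‖deriv (inverseBranch f O w) x‖ₑ < ⊤
  -- covering, modulo a countable set (the values of `f` at endpoints are irrelevant)
  covering : ∀ n : ℕ, 1 ≤ n → ∃ N : ℕ, ∀ w : Fin n → ι, (cylinder f O w).Nonempty →
    (Ico (0 : ℝ) 1 \ f^[N] '' cylinder f O w).Countable
  contDiffOn_fibre : ∀ i, ContDiffOn ℝ 1 τ (O i)
  -- `τ` is not Lipschitz-cohomologous to a piecewise constant function
  not_cohomologous : ¬ ∃ φ : ℝ → ℝ, (∃ K : ℝ≥0, LipschitzOnWith K φ (Ico 0 1)) ∧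
    ∀ i, ∃ c : ℝ, ∀ x ∈ O i, τ x = φ (f x) - φ x + c
  fibre_regularity : ∃ C : ℝ, ∀ n : ℕ, 1 ≤ n → ∀ w : Fin n → ι, ∀ x ∈ branchDomain f O w,
    |deriv (fun y => birkhoffSum f τ n (inverseBranch f O w y)) x| ≤ C

/-! ### Function spaces and the weighted transfer operator -/

/-- Lebesgue measure on the circle `[0, 1)`. -/
def circleMeasure : Measure ℝ := volume.restrict (Ico 0 1)

/-- The norm of `C^α` of the circle; infinite for functions that are not in `C^α`. -/
def cAlphaNorm (α : ℝ≥0) (g : UnitAddCircle → ℂ) : ℝ≥0∞ :=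
  eHolderNorm α g + ⨆ x, ‖g x‖ₑ

/-- The weighted transfer operator `∑_h e^{ibτ∘h} · g∘h · |h'| · 1_{f(O_h)}`, the sum being over the
inverse branches `h` of `f`. For integrable `g` the series converges absolutely almost
everywhere. -/
def transfer (f τ : ℝ → ℝ) (O : ι → Set ℝ) (b : ℝ) (g : ℝ → ℂ) (x : ℝ) : ℂ :=
  ∑' i, (f '' O i).indicator (fun y =>
    Complex.exp (Complex.I * b * τ (Function.invFunOn f (O i) y)) *
      g (Function.invFunOn f (O i) y) * |deriv (Function.invFunOn f (O i)) y|) x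

/-- The conditions relating a Banach space `B`, included in `L¹` of the circle by `J`, to `L¹` and
`C^α`. -/
structure IsAdapted (α : ℝ≥0) {B : Type*} [NormedAddCommGroup B] [NormedSpace ℂ B]
    (J : B →ₗ[ℂ] Lp ℂ 1 circleMeasure) : Prop where
  injective : Function.Injective J
  norm_le : ∀ p : B, ‖J p‖ ≤ ‖p‖
  contains_cAlpha : ∀ g : UnitAddCircle → ℂ, cAlphaNorm α g < ⊤ →
    ∃ p : B, (J p : ℝ → ℂ) =ᵐ[circleMeasure] (fun x : ℝ => g x) ∧ ‖p‖ₑ ≤ cAlphaNorm α g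
  approx : ∀ p : B, ∀ ε : ℝ, 0 < ε → ∃ q : UnitAddCircle → ℂ,
    eLpNorm (fun x : ℝ => J p x - q x) 1 circleMeasure ≤ ENNReal.ofReal (‖p‖ * ε) ∧
    cAlphaNorm α q ≤ ENNReal.ofReal (‖p‖ * ε ^ (-(1 + (α : ℝ)⁻¹)))

/-- The bounded operator `L` on `B` is the transfer operator with weight `e^{ibτ}`. -/
def IsTransferOn (f τ : ℝ → ℝ) (O : ι → Set ℝ) (b : ℝ) {B : Type*} [NormedAddCommGroup B]
    [NormedSpace ℂ B] (J : B →ₗ[ℂ] Lp ℂ 1 circleMeasure) (L : B →L[ℂ] B) : Prop :=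
  ∀ p : B, (J (L p) : ℝ → ℂ) =ᵐ[circleMeasure] transfer f τ O b (J p)

/-- `μ` is an `f`-invariant and mixing probability measure, absolutely continuous with respect to
Lebesgue measure on the circle, whose density belongs to `B`. -/
structure IsMixingInvariant (f : ℝ → ℝ) {B : Type*} [NormedAddCommGroup B] [NormedSpace ℂ B]
    (J : B →ₗ[ℂ] Lp ℂ 1 circleMeasure) (μ : Measure ℝ) : Prop where
  isProbabilityMeasure : IsProbabilityMeasure μ
  absolutelyContinuous : μ ≪ circleMeasure
  density_mem : ∃ p : B,
    (J p : ℝ → ℂ) =ᵐ[circleMeasure] fun x => ((μ.rnDeriv circleMeasure x).toReal : ℂ)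
  invariant : Measure.map f μ = μ
  mixing : ∀ A A' : Set ℝ, MeasurableSet A → MeasurableSet A' →
    Tendsto (fun n : ℕ => μ (A ∩ f^[n] ⁻¹' A')) atTop (𝓝 (μ A * μ A'))

end SkewProduct

end

/-! If exponential decay fails, the spectral radius is 1, and some spectral value of modulus 1 lies
outside the essential spectrum. It is therefore an eigenvalue `z`. It remains to show that an
eigenvector with density `g` and `L_b g = z g` contradicts the assumption that `τ` is not
Lipschitz-cohomologous to a piecewise constant function.

The triangle inequality gives `|g| ≤ L_0 |g|`, and both sides have the same integral, so they agree
almost everywhere. Hence `|g| m` is invariant (`massMeasure_preimage`). Equality in the triangle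
inequality aligns the phases: `u = g/|g|` satisfies `e^{ibτ} u = z · u ∘ f` where `u ≠ 0`
(`ae_phase_eq`).

The main point is that the measurable function `u` is Lipschitz. The approximation property of `B`
bounds the `|g| m`-mass of a `t`-neighbourhood of the discontinuities by a power of `t`. A union
bound along the orbit then gives a positive mass of points whose inverse branches are defined, for
infinitely many `n`, on a ball of fixed radius about the `n`-th image
(`exists_frequently_mem_goodSet`). At such a point `x` that is also a Lebesgue point of `u`, bounded
distortion makes `u ∘ h` close in mean to `u x`. So `u` is close in mean to `z^{-n} e^{ibτ_n ∘ h} u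
x`, which is Lipschitz uniformly in `n`, and in the limit `u` is Lipschitz on an interval
(`exists_isLipschitzPhaseOn`). Covering spreads this to almost all of the circle
(`ae_exists_isLipschitzPhaseOn`).

Finally, let `ω` be the derivative of the argument of `u`, and let `φ` be the integral of `ω/b`.
Differentiating the phase equation shows that `τ - φ ∘ f + φ` has derivative zero almost everywhere
on each `O_i`, so it is constant there (`exists_cohomologous`), which is excluded. -/

noncomputable section

namespace SkewProduct

/-! ### Spectral theory -/

section Spectral

variable {E : Type*} [NormedAddCommGroup E] [NormedSpace ℂ E] [CompleteSpace E]

/-- An injective Browder operator is invertible. -/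
theorem IsBrowder.isUnit_of_injective {T : E →L[ℂ] E} (hT : IsBrowder T)
    (hinj : Function.Injective T) : IsUnit T := by
  obtain ⟨k, hk⟩ := hT.finite_descent
  rw [ContinuousLinearMap.isUnit_iff_bijective]
  refine ⟨hinj, fun x => ?_⟩
  -- Finite descent gives `T^k x = T^k (T y)`, and `T^k` is injective, so `x = T y`.
  have hx : (T ^ k) x ∈ (T ^ (k + 1)).range := hk ▸ ⟨x, rfl⟩
  obtain ⟨y, hy⟩ := hx
  have hinjk : Function.Injective (T ^ k : E →L[ℂ] E) := by
    rw [FunLike.coe_pow_eq_iterate]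
    exact hinj.iterate k
  refine ⟨y, hinjk ?_⟩
  rw [← hy, pow_succ]
  rfl

/-- Outside the essential spectral radius, spectral values are eigenvalues. -/
theorem exists_eigenvector_of_mem_spectrum {L : E →L[ℂ] E} (hess : essentialSpectralRadius L < 1)
    {z : ℂ} (hz : z ∈ spectrum ℂ L) (hz1 : ‖z‖ = 1) : ∃ p : E, p ≠ 0 ∧ L p = z • p := by
  have hB : IsBrowder (z • (1 : E →L[ℂ] E) - L) := by
    by_contra h
    have h1 : (‖z‖₊ : ℝ≥0∞) ≤ essentialSpectralRadius L :=
      le_iSup₂_of_le (f := fun z (_ : z ∈ essentialSpectrum L) => (‖z‖₊ : ℝ≥0∞)) z h le_rfl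
    have h2 : ‖z‖₊ = 1 := NNReal.eq hz1
    rw [h2] at h1
    exact absurd hess (not_lt.2 (by simpa using h1))
  by_contra hcon
  push Not at hcon
  refine hz ?_
  rw [spectrum.mem_resolventSet_iff, Algebra.algebraMap_eq_smul_one]
  refine hB.isUnit_of_injective ?_
  rw [injective_iff_map_eq_zero]
  intro p hp
  by_contra hp0
  exact hcon p hp0 (by
    have : z • p - L p = 0 := by simpa using hp
    exact (sub_eq_zero.1 this).symm)

/-- An operator of spectral radius less than one has exponentially decaying powers. -/
theorem exists_norm_pow_le_of_spectralRadius_lt_one {L : E →L[ℂ] E} (h : spectralRadius ℂ L < 1) :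
    ∃ C r : ℝ, 0 < r ∧ ∀ n : ℕ, ‖L ^ n‖ ≤ C * Real.exp (-r * n) := by
  obtain ⟨s, hs1, hs2⟩ := ENNReal.lt_iff_exists_nnreal_btwn.1 h
  have hs2' : s < 1 := by exact_mod_cast hs2
  have hspos : 0 < s := by
    rcases eq_or_lt_of_le (zero_le : 0 ≤ s) with h0 | h0
    · rw [← h0] at hs1; simp at hs1
    · exact h0
  have ht := spectrum.pow_nnnorm_pow_one_div_tendsto_nhds_spectralRadius L
  have hev := (ht.eventually (gt_mem_nhds hs1)).and (eventually_ge_atTop 1)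
  obtain ⟨N, hN⟩ := eventually_atTop.1 hev
  have hb : ∀ n, N ≤ n → ‖L ^ n‖ ≤ (s : ℝ) ^ n := by
    intro n hn
    obtain ⟨h1, h2⟩ := hN n hn
    have hn0 : (n : ℝ) ≠ 0 := by positivity
    have h3 : ((‖L ^ n‖₊ : ℝ≥0∞) ^ (1 / n : ℝ)) ^ (n : ℝ) ≤ (s : ℝ≥0∞) ^ (n : ℝ) :=
      ENNReal.rpow_le_rpow h1.le (by positivity)
    rw [← ENNReal.rpow_mul, one_div_mul_cancel hn0, ENNReal.rpow_one, ENNReal.rpow_natCast] at h3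
    exact_mod_cast h3
  have hlog : Real.log s < 0 := Real.log_neg (by exact_mod_cast hspos) (by exact_mod_cast hs2')
  have hexp : ∀ n : ℕ, Real.exp (-(-Real.log s) * n) = (s : ℝ) ^ n := by
    intro n
    rw [neg_neg, mul_comm, Real.exp_nat_mul, Real.exp_log (by exact_mod_cast hspos)]
  have hs0 : (0 : ℝ) < s := by exact_mod_cast hspos
  -- Gelfand's formula gives the bound only from `N` on; the finite sum absorbs the earlier powers.
  refine ⟨1 + ∑ k ∈ Finset.range N, ‖L ^ k‖ / (s : ℝ) ^ k, -Real.log s, by linarith, fun n => ?_⟩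
  rw [hexp]
  have hsum : 0 ≤ ∑ k ∈ Finset.range N, ‖L ^ k‖ / (s : ℝ) ^ k :=
    Finset.sum_nonneg fun k _ => by positivity
  rcases le_or_gt N n with hn | hn
  · refine (hb n hn).trans (le_mul_of_one_le_left (by positivity) (by linarith))
  · rw [← div_le_iff₀ (by positivity)]
    have := Finset.single_le_sum (f := fun k => ‖L ^ k‖ / (s : ℝ) ^ k)
      (fun k _ => by positivity) (Finset.mem_range.2 hn)
    linarith

/-- Either the powers decay exponentially, or there is an eigenvalue of modulus one. -/
theorem exists_decay_or_exists_eigenvector {L : E →L[ℂ] E} (h1 : spectralRadius ℂ L ≤ 1)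
    (hess : essentialSpectralRadius L < 1) :
    (∃ C r : ℝ, 0 < r ∧ ∀ n : ℕ, ‖L ^ n‖ ≤ C * Real.exp (-r * n)) ∨
      ∃ z : ℂ, ‖z‖ = 1 ∧ ∃ p : E, p ≠ 0 ∧ L p = z • p := by
  rcases h1.lt_or_eq with h | h
  · exact Or.inl (exists_norm_pow_le_of_spectralRadius_lt_one h)
  · right
    have hnt : Nontrivial E := by
      by_contra hE
      rw [not_nontrivial_iff_subsingleton] at hE
      have : Subsingleton (E →L[ℂ] E) := inferInstance
      rw [Subsingleton.elim L 0, spectrum.spectralRadius_zero] at h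
      exact zero_ne_one h
    obtain ⟨z, hz, hzr⟩ := spectrum.exists_nnnorm_eq_spectralRadius L
    have hz1 : ‖z‖ = 1 := by
      rw [h] at hzr
      have : ‖z‖₊ = 1 := by exact_mod_cast hzr
      simpa using congrArg NNReal.toReal this
    exact ⟨z, hz1, exists_eigenvector_of_mem_spectrum hess hz hz1⟩

end Spectral

/-! ### Geometry of cylinders -/

section Geometry

variable {ι : Type*} {α : ℝ≥0} {f τ : ℝ → ℝ} {O : ι → Set ℝ}

namespace IsExpandingSkewProduct

theorem isOpen (hF : IsExpandingSkewProduct α f τ O) (i : ι) : IsOpen (O i) := by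
  obtain ⟨a, c, -, -, -, h⟩ := hF.interval i
  rw [h]; exact isOpen_Ioo

theorem ordConnected (hF : IsExpandingSkewProduct α f τ O) (i : ι) : (O i).OrdConnected := by
  obtain ⟨a, c, -, -, -, h⟩ := hF.interval i
  rw [h]; exact ordConnected_Ioo

theorem subset_Ico (hF : IsExpandingSkewProduct α f τ O) (i : ι) : O i ⊆ Ico 0 1 := by
  obtain ⟨a, c, h0, -, h1, h⟩ := hF.interval i
  rw [h]
  exact fun x hx => ⟨h0.trans hx.1.le, hx.2.trans_le h1⟩

theorem contDiffAt (hF : IsExpandingSkewProduct α f τ O) {i : ι} {x : ℝ} (hx : x ∈ O i) :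
    ContDiffAt ℝ 1 f x :=
  (hF.contDiffOn i).contDiffAt ((hF.isOpen i).mem_nhds hx)

theorem contDiffAt_fibre (hF : IsExpandingSkewProduct α f τ O) {i : ι} {x : ℝ} (hx : x ∈ O i) :
    ContDiffAt ℝ 1 τ x :=
  (hF.contDiffOn_fibre i).contDiffAt ((hF.isOpen i).mem_nhds hx)

end IsExpandingSkewProduct

/-- The empty itinerary gives the whole line, not `[0, 1)`; hence the condition `1 ≤ n` wherever
containment in the circle matters. -/
theorem cylinder_zero (w : Fin 0 → ι) : cylinder f O w = univ := by
  ext x; simp [cylinder]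

theorem cylinder_succ {n : ℕ} (w : Fin (n + 1) → ι) :
    cylinder f O w = cylinder f O (fun k : Fin n => w k.castSucc) ∩
      f^[n] ⁻¹' O (w (Fin.last n)) := by
  ext x
  simp [cylinder, Fin.forall_fin_succ']

theorem cylinder_const (i : ι) : cylinder f O (fun _ : Fin 1 => i) = O i := by
  ext x
  simp [cylinder]

theorem branchDomain_const (i : ι) : branchDomain f O (fun _ : Fin 1 => i) = f '' O i := by
  simp [branchDomain, cylinder_const]

theorem inverseBranch_const (i : ι) :
    inverseBranch f O (fun _ : Fin 1 => i) = Function.invFunOn f (O i) := by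
  simp [inverseBranch, cylinder_const]

namespace IsExpandingSkewProduct

theorem contDiffAt_iterate (hF : IsExpandingSkewProduct α f τ O) :
    ∀ {n : ℕ} {w : Fin n → ι} {x : ℝ}, x ∈ cylinder f O w → ContDiffAt ℝ 1 f^[n] x
  | 0, _, _, _ => contDiffAt_id
  | n + 1, w, x, hx => by
    rw [cylinder_succ] at hx
    rw [Function.iterate_succ']
    exact (hF.contDiffAt hx.2).comp x (hF.contDiffAt_iterate hx.1)

theorem isOpen_cylinder (hF : IsExpandingSkewProduct α f τ O) :
    ∀ {n : ℕ} (w : Fin n → ι), IsOpen (cylinder f O w)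
  | 0, w => by rw [cylinder_zero]; exact isOpen_univ
  | n + 1, w => by
    rw [cylinder_succ]
    exact ContinuousOn.isOpen_inter_preimage
      (fun x hx => (hF.contDiffAt_iterate hx).continuousAt.continuousWithinAt)
      (hF.isOpen_cylinder _) (hF.isOpen _)

/-- The two claims are proved together: monotonicity of `f^n` is what makes the preimage of the next
interval order-connected. -/
theorem monotone_iterate (hF : IsExpandingSkewProduct α f τ O) :
    ∀ {n : ℕ} (w : Fin n → ι), (cylinder f O w).OrdConnected ∧
      (StrictMonoOn f^[n] (cylinder f O w) ∨ StrictAntiOn f^[n] (cylinder f O w))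
  | 0, w => by
    rw [cylinder_zero]
    exact ⟨ordConnected_univ, Or.inl fun x _ y _ h => h⟩
  | n + 1, w => by
    obtain ⟨hoc, hm⟩ := hF.monotone_iterate (fun k : Fin n => w k.castSucc)
    have hm' : MonotoneOn f^[n] (cylinder f O fun k : Fin n => w k.castSucc) ∨
        AntitoneOn f^[n] (cylinder f O fun k : Fin n => w k.castSucc) :=
      hm.imp StrictMonoOn.monotoneOn StrictAntiOn.antitoneOn
    constructor
    · rw [cylinder_succ]
      refine ⟨fun x hx y hy t ht => ?_⟩
      have htc := hoc.out hx.1 hy.1 ht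
      refine ⟨htc, ?_⟩
      rcases hm' with h | h
      · exact (hF.ordConnected _).out hx.2 hy.2 ⟨h hx.1 htc ht.1, h htc hy.1 ht.2⟩
      · exact (hF.ordConnected _).out hy.2 hx.2 ⟨h htc hy.1 ht.2, h hx.1 htc ht.1⟩
    · rw [cylinder_succ, Function.iterate_succ']
      have hmap : MapsTo f^[n] ((cylinder f O fun k : Fin n => w k.castSucc) ∩
          f^[n] ⁻¹' O (w (Fin.last n))) (O (w (Fin.last n))) := fun x hx => hx.2
      rcases hm with h | h <;> rcases hF.monotone (w (Fin.last n)) with h' | h'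
      · exact Or.inl (h'.comp (h.mono inter_subset_left) hmap)
      · exact Or.inr (h'.comp_strictMonoOn (h.mono inter_subset_left) hmap)
      · exact Or.inr (h'.comp_strictAntiOn (h.mono inter_subset_left) hmap)
      · exact Or.inl (h'.comp (h.mono inter_subset_left) hmap)

theorem ordConnected_cylinder (hF : IsExpandingSkewProduct α f τ O) {n : ℕ} (w : Fin n → ι) :
    (cylinder f O w).OrdConnected := (hF.monotone_iterate w).1

theorem injOn_iterate (hF : IsExpandingSkewProduct α f τ O) {n : ℕ} (w : Fin n → ι) :
    InjOn f^[n] (cylinder f O w) :=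
  (hF.monotone_iterate w).2.elim StrictMonoOn.injOn StrictAntiOn.injOn

theorem inverseBranch_mem {n : ℕ} {w : Fin n → ι} {y : ℝ} (hy : y ∈ branchDomain f O w) :
    inverseBranch f O w y ∈ cylinder f O w := Function.invFunOn_mem hy

theorem iterate_inverseBranch {n : ℕ} {w : Fin n → ι} {y : ℝ} (hy : y ∈ branchDomain f O w) :
    f^[n] (inverseBranch f O w y) = y := Function.invFunOn_eq hy

theorem inverseBranch_iterate (hF : IsExpandingSkewProduct α f τ O) {n : ℕ} {w : Fin n → ι}
    {x : ℝ} (hx : x ∈ cylinder f O w) : inverseBranch f O w (f^[n] x) = x :=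
  hF.injOn_iterate w (inverseBranch_mem ⟨x, hx, rfl⟩) hx (iterate_inverseBranch ⟨x, hx, rfl⟩)

/-- A rate of expansion of `f`. -/
def rate (hF : IsExpandingSkewProduct α f τ O) : ℝ := hF.expanding.choose

theorem rate_pos (hF : IsExpandingSkewProduct α f τ O) : 0 < hF.rate :=
  (Real.log_pos one_lt_two).trans hF.expanding.choose_spec.1

theorem exp_le_abs_deriv (hF : IsExpandingSkewProduct α f τ O) {n : ℕ} {w : Fin n → ι}
    {x : ℝ} (hx : x ∈ cylinder f O w) : Real.exp (hF.rate * n) ≤ |deriv f^[n] x| := by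
  rcases Nat.eq_zero_or_pos n with rfl | hn
  · simp
  · exact hF.expanding.choose_spec.2 n hn w x hx

theorem deriv_iterate_ne_zero (hF : IsExpandingSkewProduct α f τ O) {n : ℕ} {w : Fin n → ι}
    {x : ℝ} (hx : x ∈ cylinder f O w) : deriv f^[n] x ≠ 0 :=
  abs_pos.1 ((Real.exp_pos _).trans_le (hF.exp_le_abs_deriv hx))

theorem differentiableAt_iterate (hF : IsExpandingSkewProduct α f τ O) {n : ℕ} {w : Fin n → ι}
    {x : ℝ} (hx : x ∈ cylinder f O w) : DifferentiableAt ℝ f^[n] x :=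
  (hF.contDiffAt_iterate hx).differentiableAt one_ne_zero

/-- Mean value theorem on the segment from `x` to `y`, which stays in the cylinder. -/
theorem expansion (hF : IsExpandingSkewProduct α f τ O) {n : ℕ} {w : Fin n → ι} {x y : ℝ}
    (hx : x ∈ cylinder f O w) (hy : y ∈ cylinder f O w) :
    |x - y| ≤ Real.exp (-hF.rate * n) * |f^[n] x - f^[n] y| := by
  wlog hxy : x < y generalizing x y
  · rcases (not_lt.1 hxy).eq_or_lt with h | h
    · rw [h]; simp
    · rw [abs_sub_comm, abs_sub_comm (f^[n] x)]
      exact this hy hx h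
  have hsub : Icc x y ⊆ cylinder f O w := (hF.ordConnected_cylinder w).out hx hy
  obtain ⟨c, hc, hc'⟩ := exists_deriv_eq_slope f^[n] hxy
    (fun t ht => (hF.differentiableAt_iterate (hsub ht)).continuousAt.continuousWithinAt)
    (fun t ht => (hF.differentiableAt_iterate
      (hsub (Ioo_subset_Icc_self ht))).differentiableWithinAt)
  have h1 := hF.exp_le_abs_deriv (hsub (Ioo_subset_Icc_self hc))
  have hpos : 0 < |y - x| := abs_pos.2 (by linarith)
  rw [hc', abs_div, le_div_iff₀ hpos] at h1
  rw [abs_sub_comm x, abs_sub_comm (f^[n] x), neg_mul, Real.exp_neg,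
    inv_mul_eq_div, le_div_iff₀ (Real.exp_pos _), mul_comm]
  exact h1

theorem abs_inverseBranch_sub_le (hF : IsExpandingSkewProduct α f τ O) {n : ℕ} {w : Fin n → ι}
    {x y : ℝ} (hx : x ∈ branchDomain f O w) (hy : y ∈ branchDomain f O w) :
    |inverseBranch f O w x - inverseBranch f O w y| ≤ Real.exp (-hF.rate * n) * |x - y| := by
  simpa only [iterate_inverseBranch hx, iterate_inverseBranch hy] using
    hF.expansion (inverseBranch_mem hx) (inverseBranch_mem hy)

theorem isOpen_image_iterate (hF : IsExpandingSkewProduct α f τ O) {n : ℕ} {w : Fin n → ι}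
    {U : Set ℝ} (hU : IsOpen U) (hUw : U ⊆ cylinder f O w) : IsOpen (f^[n] '' U) := by
  rw [isOpen_iff_mem_nhds]
  rintro _ ⟨x, hx, rfl⟩
  have h1 := (hF.contDiffAt_iterate (hUw hx)).hasStrictDerivAt one_ne_zero
  rw [← h1.map_nhds_eq (hF.deriv_iterate_ne_zero (hUw hx))]
  exact image_mem_map (hU.mem_nhds hx)

theorem isOpen_branchDomain (hF : IsExpandingSkewProduct α f τ O) {n : ℕ} (w : Fin n → ι) :
    IsOpen (branchDomain f O w) :=
  hF.isOpen_image_iterate (hF.isOpen_cylinder w) Subset.rfl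

theorem ordConnected_branchDomain (hF : IsExpandingSkewProduct α f τ O) {n : ℕ} (w : Fin n → ι) :
    (branchDomain f O w).OrdConnected := by
  refine IsPreconnected.ordConnected (IsPreconnected.image ?_ _ fun x hx =>
    (hF.contDiffAt_iterate hx).continuousAt.continuousWithinAt)
  exact (hF.ordConnected_cylinder w).isPreconnected

theorem hasDerivAt_inverseBranch (hF : IsExpandingSkewProduct α f τ O) {n : ℕ} {w : Fin n → ι}
    {y : ℝ} (hy : y ∈ branchDomain f O w) :
    HasDerivAt (inverseBranch f O w) (deriv f^[n] (inverseBranch f O w y))⁻¹ y := by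
  have hnhds := (hF.isOpen_branchDomain w).mem_nhds hy
  refine HasDerivAt.of_local_left_inverse (f := f^[n]) ?_
    (hF.differentiableAt_iterate (inverseBranch_mem hy)).hasDerivAt
    (hF.deriv_iterate_ne_zero (inverseBranch_mem hy)) ?_
  · have hl : LipschitzOnWith (Real.exp (-hF.rate * n)).toNNReal (inverseBranch f O w)
        (branchDomain f O w) := by
      refine LipschitzOnWith.of_dist_le_mul fun s hs t ht => ?_
      rw [Real.coe_toNNReal _ (Real.exp_pos _).le]
      exact hF.abs_inverseBranch_sub_le hs ht
    exact hl.continuousOn.continuousAt hnhds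
  · filter_upwards [hnhds] with t ht using iterate_inverseBranch ht

theorem deriv_inverseBranch_ne_zero (hF : IsExpandingSkewProduct α f τ O) {n : ℕ}
    {w : Fin n → ι} {y : ℝ} (hy : y ∈ branchDomain f O w) :
    deriv (inverseBranch f O w) y ≠ 0 := by
  rw [(hF.hasDerivAt_inverseBranch hy).deriv]
  exact inv_ne_zero (hF.deriv_iterate_ne_zero (inverseBranch_mem hy))

theorem abs_deriv_inverseBranch_le (hF : IsExpandingSkewProduct α f τ O) {n : ℕ}
    {w : Fin n → ι} {y : ℝ} (hy : y ∈ branchDomain f O w) :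
    |deriv (inverseBranch f O w) y| ≤ Real.exp (-hF.rate * n) := by
  rw [(hF.hasDerivAt_inverseBranch hy).deriv, abs_inv, neg_mul, Real.exp_neg]
  exact inv_anti₀ (Real.exp_pos _) (hF.exp_le_abs_deriv (inverseBranch_mem hy))

theorem differentiableAt_birkhoffSum (hF : IsExpandingSkewProduct α f τ O) {n : ℕ}
    {w : Fin n → ι} {x : ℝ} (hx : x ∈ cylinder f O w) :
    DifferentiableAt ℝ (birkhoffSum f τ n) x := by
  unfold birkhoffSum
  refine DifferentiableAt.fun_sum fun k hk => ?_
  have hk' := Finset.mem_range.1 hk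
  have h1 : x ∈ cylinder f O (fun j : Fin k => w (j.castLE hk'.le)) :=
    fun j => hx (j.castLE hk'.le)
  exact ((hF.contDiffAt_fibre (hx ⟨k, hk'⟩)).differentiableAt one_ne_zero).comp x
    (hF.differentiableAt_iterate h1)

/-- A common Lipschitz constant of the functions `τ_n ∘ h`. -/
def fibreConst (hF : IsExpandingSkewProduct α f τ O) : ℝ≥0 :=
  hF.fibre_regularity.choose.toNNReal

theorem abs_birkhoffSum_inverseBranch_sub_le (hF : IsExpandingSkewProduct α f τ O) {n : ℕ}
    {w : Fin n → ι} {x y : ℝ} (hx : x ∈ branchDomain f O w) (hy : y ∈ branchDomain f O w) :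
    |birkhoffSum f τ n (inverseBranch f O w x) - birkhoffSum f τ n (inverseBranch f O w y)| ≤
      hF.fibreConst * |x - y| := by
  rcases Nat.eq_zero_or_pos n with rfl | hn
  · simp only [birkhoffSum_zero, sub_self, abs_zero]
    positivity
  refine (hF.ordConnected_branchDomain w).convex.norm_image_sub_le_of_norm_deriv_le
    (f := fun y => birkhoffSum f τ n (inverseBranch f O w y)) (fun t ht => ?_) (fun t ht => ?_)
    hy hx
  · exact (hF.differentiableAt_birkhoffSum (inverseBranch_mem ht)).comp t
      (hF.hasDerivAt_inverseBranch ht).differentiableAt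
  · exact (hF.fibre_regularity.choose_spec n hn w t ht).trans (Real.le_coe_toNNReal _)

end IsExpandingSkewProduct

end Geometry

/-- Equality in the triangle inequality for an absolutely convergent series. -/
theorem eq_norm_mul_of_norm_tsum_eq {ι : Type*} {a : ι → ℂ} (ha : Summable fun i => ‖a i‖)
    (h : ‖∑' i, a i‖ = ∑' i, ‖a i‖) (i : ι) :
    a i = ‖a i‖ * ((∑' j, a j) / ‖∑' j, a j‖) := by
  set S := ∑' j, a j with hS
  by_cases hS0 : S = 0
  · have h1 : ‖a i‖ ≤ ∑' j, ‖a j‖ := ha.le_tsum i fun j _ => norm_nonneg _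
    rw [← h, hS0, norm_zero] at h1
    rw [hS0, zero_div, mul_zero]
    exact norm_le_zero_iff.1 h1
  · have hn : ‖S‖ ≠ 0 := norm_ne_zero_iff.2 hS0
    have hnC : (‖S‖ : ℂ) ≠ 0 := by exact_mod_cast hn
    -- After rotation by `c` the sum is the real number `‖S‖`. The terms `‖a j‖ - Re (a j * c)` are
    -- then nonnegative with sum zero, so each vanishes.
    set c : ℂ := (starRingEnd ℂ) S / ‖S‖ with hc
    have hcn : ‖c‖ = 1 := by
      rw [hc, norm_div, Complex.norm_conj, Complex.norm_real, norm_norm, div_self hn]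
    have hSc : S * c = ‖S‖ := by
      rw [hc, mul_div_assoc', Complex.mul_conj, Complex.normSq_eq_norm_sq]
      field_simp
      push_cast; ring
    have hsumm : Summable a := ha.of_norm
    have hre : HasSum (fun j => (a j * c).re) ‖S‖ := by
      have := Complex.hasSum_re (hsumm.hasSum.mul_right c)
      rwa [← hS, hSc, Complex.ofReal_re] at this
    have hdiff : HasSum (fun j => ‖a j‖ - (a j * c).re) 0 := by
      have := ha.hasSum.sub hre
      rwa [← h, sub_self] at this
    have hle : ∀ j, (a j * c).re ≤ ‖a j‖ := fun j => by
      have := Complex.re_le_norm (a j * c)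
      rwa [norm_mul, hcn, mul_one] at this
    have hz := (hasSum_zero_iff_of_nonneg fun j => sub_nonneg.2 (hle j)).1 hdiff
    have hi : (a i * c).re = ‖a i * c‖ := by
      have := congrFun hz i
      simp only [Pi.zero_apply] at this
      rw [norm_mul, hcn, mul_one]
      linarith
    have hi' : a i * c = ‖a i‖ := by
      rw [Complex.re_eq_norm] at hi
      rw [Complex.eq_coe_norm_of_nonneg hi, norm_mul, hcn, mul_one]
    rw [← hi', mul_assoc, mul_div_assoc', mul_comm c, hSc, div_self hnC, mul_one]

/-! ### Null sets, the invariant measure `|g| m` and the phase of an eigenfunction. -/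

section Measure

variable {ι : Type*} {α : ℝ≥0} {f τ : ℝ → ℝ} {O : ι → Set ℝ}

/-- The points whose forward orbit stays in the union of the partition elements. -/
def regularSet (f : ℝ → ℝ) (O : ι → Set ℝ) : Set ℝ := {x | ∀ k : ℕ, ∃ i, f^[k] x ∈ O i}

/-- The mass `∑_h |g ∘ h| |h'|` carried by the inverse branches. -/
def branchMass (f : ℝ → ℝ) (O : ι → Set ℝ) (g : ℝ → ℂ) (x : ℝ) : ℝ≥0∞ :=
  ∑' i, (f '' O i).indicator (fun y => ENNReal.ofReal |deriv (Function.invFunOn f (O i)) y| *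
    ‖g (Function.invFunOn f (O i) y)‖ₑ) x

/-- The measure `|g| m`. -/
def massMeasure (g : ℝ → ℂ) : Measure ℝ := circleMeasure.withDensity fun x => ‖g x‖ₑ

/-- The phase `g / |g|`, which vanishes where `g` does. -/
def phase (g : ℝ → ℂ) (x : ℝ) : ℂ := g x / ‖g x‖

theorem norm_phase_le (g : ℝ → ℂ) (x : ℝ) : ‖phase g x‖ ≤ 1 := by
  rw [phase, norm_div, Complex.norm_real, norm_norm]
  exact div_self_le_one _

theorem norm_phase {g : ℝ → ℂ} {x : ℝ} (h : phase g x ≠ 0) : ‖phase g x‖ = 1 := by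
  have hg : g x ≠ 0 := fun h0 => h (by rw [phase, h0, zero_div])
  rw [phase, norm_div, Complex.norm_real, norm_norm, div_self (norm_ne_zero_iff.2 hg)]

theorem phase_ne_zero {g : ℝ → ℂ} {x : ℝ} (h : g x ≠ 0) : phase g x ≠ 0 :=
  div_ne_zero h (by exact_mod_cast norm_ne_zero_iff.2 h)

theorem measurable_phase {g : ℝ → ℂ} (hg : Measurable g) : Measurable (phase g) :=
  hg.div (Complex.measurable_ofReal.comp hg.norm)

theorem ae_circleMeasure_iff {P : ℝ → Prop} :
    (∀ᵐ x ∂circleMeasure, P x) ↔ ∀ᵐ x : ℝ, x ∈ Ico (0 : ℝ) 1 → P x :=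
  ae_restrict_iff' measurableSet_Ico

namespace IsExpandingSkewProduct

theorem mapsTo_iterate (hF : IsExpandingSkewProduct α f τ O) (n : ℕ) :
    MapsTo f^[n] (Ico 0 1) (Ico 0 1) := hF.mapsTo.iterate n

theorem image_subset_Ico (hF : IsExpandingSkewProduct α f τ O) (i : ι) : f '' O i ⊆ Ico 0 1 :=
  (image_mono (hF.subset_Ico i)).trans hF.mapsTo.image_subset

theorem volume_image_iterate_eq_zero (hF : IsExpandingSkewProduct α f τ O) {n : ℕ}
    {w : Fin n → ι} {s : Set ℝ} (hs : s ⊆ cylinder f O w) (h0 : volume s = 0) :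
    volume (f^[n] '' s) = 0 :=
  addHaar_image_eq_zero_of_differentiableOn_of_addHaar_eq_zero volume
    (fun _ hx => (hF.differentiableAt_iterate (hs hx)).differentiableWithinAt) h0

/-- Nonsingularity of `f^n`: this preimage is the image of a null set under a differentiable inverse
branch. -/
theorem volume_cylinder_inter_preimage_eq_zero (hF : IsExpandingSkewProduct α f τ O) {n : ℕ}
    (w : Fin n → ι) {s : Set ℝ} (h0 : volume s = 0) :
    volume (cylinder f O w ∩ f^[n] ⁻¹' s) = 0 := by
  have h1 : volume (inverseBranch f O w '' (s ∩ branchDomain f O w)) = 0 :=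
    addHaar_image_eq_zero_of_differentiableOn_of_addHaar_eq_zero volume
      (fun x hx => (hF.hasDerivAt_inverseBranch hx.2).differentiableAt.differentiableWithinAt)
      (measure_mono_null inter_subset_left h0)
  refine measure_mono_null ?_ h1
  rintro x ⟨hx, hxs⟩
  exact ⟨f^[n] x, ⟨hxs, x, hx, rfl⟩, hF.inverseBranch_iterate hx⟩

theorem injOn (hF : IsExpandingSkewProduct α f τ O) (i : ι) : InjOn f (O i) :=
  (hF.monotone i).elim StrictMonoOn.injOn StrictAntiOn.injOn

theorem countable_inter_preimage [Countable ι] (hF : IsExpandingSkewProduct α f τ O)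
    {s : Set ℝ} (hs : s.Countable) : (Ico 0 1 ∩ f ⁻¹' s).Countable := by
  have h1 : (Ico 0 1 ∩ f ⁻¹' s) ⊆ (Ico (0 : ℝ) 1 \ ⋃ i, O i) ∪ ⋃ i, (O i ∩ f ⁻¹' s) := by
    rintro x ⟨hx, hxs⟩
    by_cases h : x ∈ ⋃ i, O i
    · obtain ⟨i, hi⟩ := mem_iUnion.1 h
      exact Or.inr (mem_iUnion.2 ⟨i, hi, hxs⟩)
    · exact Or.inl ⟨hx, h⟩
  refine (hF.cover.union (countable_iUnion fun i => ?_)).mono h1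
  refine countable_of_injective_of_countable_image ((hF.injOn i).mono inter_subset_left)
    (hs.mono ?_)
  rintro _ ⟨x, hx, rfl⟩
  exact hx.2

theorem countable_diff_regularSet [Countable ι] (hF : IsExpandingSkewProduct α f τ O) :
    (Ico 0 1 \ regularSet f O).Countable := by
  have h1 : ∀ k : ℕ, ∀ s : Set ℝ, s.Countable → (Ico 0 1 ∩ f^[k] ⁻¹' s).Countable := by
    intro k
    induction k with
    | zero => exact fun s hs => hs.mono inter_subset_right
    | succ k ih =>
      intro s hs
      refine (ih _ (hF.countable_inter_preimage hs)).mono ?_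
      rintro x ⟨hx, hxs⟩
      refine ⟨hx, hF.mapsTo_iterate k hx, ?_⟩
      rwa [mem_preimage, Function.iterate_succ_apply'] at hxs
  refine (countable_iUnion fun k => h1 k _ hF.cover).mono ?_
  rintro x ⟨hx, hxr⟩
  simp only [regularSet, mem_ofPred_eq, not_forall, not_exists] at hxr
  obtain ⟨k, hk⟩ := hxr
  refine mem_iUnion.2 ⟨k, hx, hF.mapsTo_iterate k hx, ?_⟩
  simpa using hk

theorem ae_mem_regularSet [Countable ι] (hF : IsExpandingSkewProduct α f τ O) :
    ∀ᵐ x ∂circleMeasure, x ∈ regularSet f O := by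
  rw [ae_circleMeasure_iff]
  refine measure_mono_null ?_ (hF.countable_diff_regularSet.measure_zero volume)
  intro x hx
  simpa [and_assoc] using hx

theorem ae_comp [Countable ι] (hF : IsExpandingSkewProduct α f τ O) {P : ℝ → Prop}
    (h : ∀ᵐ x ∂circleMeasure, P x) : ∀ᵐ x ∂circleMeasure, P (f x) := by
  rw [ae_circleMeasure_iff] at h
  have h1 : ∀ i, ∀ᵐ x : ℝ, x ∈ O i → P (f x) := by
    intro i
    have := hF.volume_cylinder_inter_preimage_eq_zero (fun _ : Fin 1 => i) h
    refine measure_mono_null ?_ this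
    intro x hx
    simp only [mem_compl_iff, mem_ofPred_eq, not_forall] at hx
    obtain ⟨hxi, hx⟩ := hx
    rw [cylinder_const]
    refine ⟨hxi, ?_⟩
    simp only [Function.iterate_one, mem_preimage, mem_compl_iff, mem_ofPred_eq, not_forall]
    exact ⟨hF.mapsTo (hF.subset_Ico i hxi), hx⟩
  filter_upwards [hF.ae_mem_regularSet, ae_restrict_of_ae (ae_all_iff.2 h1)] with x hx hx1
  obtain ⟨i, hi⟩ := hx 0
  exact hx1 i hi

theorem ae_comp_iterate [Countable ι] (hF : IsExpandingSkewProduct α f τ O) {P : ℝ → Prop}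
    (h : ∀ᵐ x ∂circleMeasure, P x) : ∀ n : ℕ, ∀ᵐ x ∂circleMeasure, P (f^[n] x)
  | 0 => h
  | n + 1 => by
    simpa only [Function.iterate_succ_apply] using hF.ae_comp (hF.ae_comp_iterate h n)

theorem hasDerivAt_invFunOn (hF : IsExpandingSkewProduct α f τ O) {i : ι} {y : ℝ}
    (hy : y ∈ f '' O i) : HasDerivAt (Function.invFunOn f (O i))
      (deriv (Function.invFunOn f (O i)) y) y := by
  rw [← inverseBranch_const]
  rw [← branchDomain_const] at hy
  exact (hF.hasDerivAt_inverseBranch hy).differentiableAt.hasDerivAt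

theorem isOpen_image (hF : IsExpandingSkewProduct α f τ O) (i : ι) : IsOpen (f '' O i) := by
  rw [← branchDomain_const]
  exact hF.isOpen_branchDomain _

theorem invFunOn_apply (hF : IsExpandingSkewProduct α f τ O) {i : ι} {x : ℝ} (hx : x ∈ O i) :
    Function.invFunOn f (O i) (f x) = x := by
  have := hF.inverseBranch_iterate (w := fun _ : Fin 1 => i) (x := x) (by rwa [cylinder_const])
  rwa [inverseBranch_const] at this

theorem measurable_branchMass_term (hF : IsExpandingSkewProduct α f τ O) {g : ℝ → ℂ}
    (hg : Measurable g) (i : ι) :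
    Measurable ((f '' O i).indicator fun y =>
      ENNReal.ofReal |deriv (Function.invFunOn f (O i)) y| *
        ‖g (Function.invFunOn f (O i) y)‖ₑ) := by
  classical
  have hm : MeasurableSet (f '' O i) := (hF.isOpen_image i).measurableSet
  have hcont : ContinuousOn (Function.invFunOn f (O i)) (f '' O i) := fun y hy =>
    (hF.hasDerivAt_invFunOn hy).continuousAt.continuousWithinAt
  -- Outside `f '' O i` the chosen inverse is arbitrary, so it is replaced by zero there before
  -- measurability is claimed.
  have h1 : Measurable ((f '' O i).piecewise (Function.invFunOn f (O i)) fun _ => (0 : ℝ)) :=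
    hcont.measurable_piecewise continuousOn_const hm
  have h2 : Measurable ((f '' O i).indicator fun y =>
      ENNReal.ofReal |deriv (Function.invFunOn f (O i)) y| *
        ‖g ((f '' O i).piecewise (Function.invFunOn f (O i)) (fun _ => (0 : ℝ)) y)‖ₑ) := by
    refine Measurable.indicator ?_ hm
    exact (ENNReal.measurable_ofReal.comp (measurable_deriv _).abs).mul (hg.comp h1).enorm
  convert h2 using 1
  refine indicator_congr fun y hy => ?_
  rw [piecewise_eq_of_mem _ _ _ hy]

theorem measurableSet_inter_preimage (hF : IsExpandingSkewProduct α f τ O) (i : ι) {A : Set ℝ}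
    (hA : MeasurableSet A) : MeasurableSet (O i ∩ f ⁻¹' A) := by
  classical
  have hm := (hF.isOpen i).measurableSet
  have h1 : Measurable ((O i).piecewise f fun _ => (0 : ℝ)) :=
    (hF.contDiffOn i).continuousOn.measurable_piecewise continuousOn_const hm
  convert hm.inter (h1 hA) using 1
  ext x
  simp only [mem_inter_iff, mem_preimage]
  refine and_congr_right fun hx => ?_
  rw [piecewise_eq_of_mem _ _ _ hx]

/-- Duality of the untwisted transfer operator with composition by `f`, from the change of variables
on each branch. -/
theorem setLIntegral_branchMass [Countable ι] (hF : IsExpandingSkewProduct α f τ O) {g : ℝ → ℂ}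
    (hg : Measurable g) {A : Set ℝ} (hA : MeasurableSet A) :
    ∫⁻ x in A, branchMass f O g x ∂circleMeasure = massMeasure g (f ⁻¹' A) := by
  have hstep : ∀ i, ∫⁻ x in A, (f '' O i).indicator (fun y =>
      ENNReal.ofReal |deriv (Function.invFunOn f (O i)) y| *
        ‖g (Function.invFunOn f (O i) y)‖ₑ) x ∂circleMeasure =
        massMeasure g (O i ∩ f ⁻¹' A) := by
    intro i
    have hm : MeasurableSet (f '' O i) := (hF.isOpen_image i).measurableSet
    rw [lintegral_indicator hm, Measure.restrict_restrict hm, circleMeasure,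
      Measure.restrict_restrict_of_subset
        (inter_subset_left.trans (hF.image_subset_Ico i)), massMeasure,
      withDensity_apply _ (hF.measurableSet_inter_preimage i hA), circleMeasure,
      Measure.restrict_restrict_of_subset (inter_subset_left.trans (hF.subset_Ico i))]
    rw [← lintegral_image_eq_lintegral_abs_deriv_mul (hm.inter hA)
      (fun y hy => (hF.hasDerivAt_invFunOn hy.1).hasDerivWithinAt) ?_ (fun x => ‖g x‖ₑ)]
    · congr 2
      ext x
      constructor
      · rintro ⟨_, ⟨⟨t, ht, rfl⟩, hA'⟩, rfl⟩
        rw [hF.invFunOn_apply ht]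
        exact ⟨ht, hA'⟩
      · rintro ⟨hx, hxA⟩
        exact ⟨f x, ⟨⟨x, hx, rfl⟩, hxA⟩, hF.invFunOn_apply hx⟩
    · rintro _ ⟨⟨s, hs, rfl⟩, -⟩ _ ⟨⟨t, ht, rfl⟩, -⟩ h
      rw [hF.invFunOn_apply hs, hF.invFunOn_apply ht] at h
      rw [h]
  unfold branchMass
  rw [lintegral_tsum fun i => (hF.measurable_branchMass_term hg i).aemeasurable]
  simp_rw [hstep]
  rw [← measure_iUnion _ fun i => hF.measurableSet_inter_preimage i hA]
  -- `f ⁻¹' A` itself need not be measurable; it agrees almost everywhere with the union of its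
  -- measurable pieces in the `O i`.
  · refine measure_congr ?_
    have hac : massMeasure g ≪ circleMeasure := withDensity_absolutelyContinuous _ _
    filter_upwards [hac.ae_le hF.ae_mem_regularSet] with x hx
    obtain ⟨i, hi⟩ := hx 0
    refine propext ⟨fun h => ?_, fun h => mem_iUnion.2 ⟨i, hi, h⟩⟩
    obtain ⟨j, hj⟩ := mem_iUnion.1 h
    exact hj.2
  · intro i j hij
    exact (hF.disjoint hij).mono inter_subset_left inter_subset_left

section Eigenfunction

variable [Countable ι] (hF : IsExpandingSkewProduct α f τ O) {b : ℝ} {z : ℂ} (hz : ‖z‖ = 1)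
  {g : ℝ → ℂ} (hg : Measurable g) (hgi : ∫⁻ x, ‖g x‖ₑ ∂circleMeasure ≠ ⊤)
  (htr : transfer f τ O b g =ᵐ[circleMeasure] fun x => z * g x)

omit [Countable ι] in
theorem enorm_transfer_term (i : ι) (y : ℝ) :
    ‖(f '' O i).indicator (fun y =>
      Complex.exp (Complex.I * b * τ (Function.invFunOn f (O i) y)) *
      g (Function.invFunOn f (O i) y) * |deriv (Function.invFunOn f (O i)) y|) y‖ₑ =
    (f '' O i).indicator (fun y => ENNReal.ofReal |deriv (Function.invFunOn f (O i)) y| *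
      ‖g (Function.invFunOn f (O i) y)‖ₑ) y := by
  by_cases hy : y ∈ f '' O i
  · have h1 : ∀ t : ℝ, ‖Complex.exp (Complex.I * b * t)‖ₑ = 1 := fun t => by
      rw [← ofReal_norm, mul_assoc, mul_comm Complex.I, ← Complex.ofReal_mul,
        Complex.norm_exp_ofReal_mul_I, ENNReal.ofReal_one]
    rw [indicator_of_mem hy, indicator_of_mem hy, enorm_mul, enorm_mul, h1, one_mul, mul_comm]
    congr 1
    rw [← ofReal_norm, Complex.norm_real, Real.norm_eq_abs, abs_abs]
  · rw [indicator_of_notMem hy, indicator_of_notMem hy, enorm_zero]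

include hF hz hg hgi htr

/-- The triangle inequality gives `≥`, and the two functions have the same finite integral. -/
theorem branchMass_ae_eq : branchMass f O g =ᵐ[circleMeasure] fun x => ‖g x‖ₑ := by
  have hle : (fun x => ‖g x‖ₑ) ≤ᵐ[circleMeasure] branchMass f O g := by
    filter_upwards [htr] with x hx
    have h1 : ‖g x‖ₑ = ‖transfer f τ O b g x‖ₑ := by
      have : ‖z‖ₑ = 1 := by rw [← ofReal_norm, hz, ENNReal.ofReal_one]
      rw [hx, enorm_mul, this, one_mul]
    rw [h1, branchMass, transfer]
    simp_rw [← enorm_transfer_term (τ := τ) (b := b)]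
    exact enorm_tsum_le_tsum_enorm
  refine (ae_eq_of_ae_le_of_lintegral_le hle hgi ?_ ?_).symm
  · exact (Measurable.tsum fun i => hF.measurable_branchMass_term hg i).aemeasurable
  · have := hF.setLIntegral_branchMass hg MeasurableSet.univ
    rw [Measure.restrict_univ, preimage_univ] at this
    rw [this, massMeasure, withDensity_apply _ MeasurableSet.univ, Measure.restrict_univ]

theorem massMeasure_preimage {A : Set ℝ} (hA : MeasurableSet A) :
    massMeasure g (f ⁻¹' A) = massMeasure g A := by
  rw [← hF.setLIntegral_branchMass hg hA, massMeasure, withDensity_apply _ hA]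
  exact lintegral_congr_ae (ae_restrict_of_ae (hF.branchMass_ae_eq hz hg hgi htr))

/-- At `y = f x` the series for `z * g y` attains equality in the triangle inequality, so the term
of the branch through `x` has the argument of `z * g y`. -/
theorem ae_phase_eq : ∀ᵐ x ∂circleMeasure, phase g x ≠ 0 →
    Complex.exp (Complex.I * b * τ x) * phase g x = z * phase g (f x) := by
  have hall := hF.ae_comp (htr.and (hF.branchMass_ae_eq hz hg hgi htr))
  filter_upwards [hF.ae_mem_regularSet, hall] with x hx ⟨h1, h2⟩ hgx
  obtain ⟨i, hi⟩ := hx 0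
  simp only [Function.iterate_zero, id_eq] at hi
  set y := f x with hy
  set a : ι → ℂ := fun i => (f '' O i).indicator (fun y =>
      Complex.exp (Complex.I * b * τ (Function.invFunOn f (O i) y)) *
      g (Function.invFunOn f (O i) y) * |deriv (Function.invFunOn f (O i)) y|) y with ha
  have hS : ∑' i, a i = z * g y := h1
  have hT : ∑' i, ‖a i‖ₑ = ‖g y‖ₑ := by
    rw [← h2, branchMass]
    exact tsum_congr fun i => enorm_transfer_term i y
  have hsumm : Summable fun i => ‖a i‖ := by
    have h3 : Summable fun i => ‖a i‖₊ := by
      rw [← ENNReal.tsum_coe_ne_top_iff_summable]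
      exact (hT.trans_ne enorm_ne_top :)
    exact NNReal.summable_coe.2 h3
  have hn : ‖∑' i, a i‖ = ∑' i, ‖a i‖ := by
    rw [hS, norm_mul, hz, one_mul]
    have h4 : ENNReal.ofReal ‖g y‖ = ENNReal.ofReal (∑' i, ‖a i‖) := by
      rw [ENNReal.ofReal_tsum_of_nonneg (fun i => norm_nonneg _) hsumm]
      simp_rw [ofReal_norm]
      exact hT.symm
    exact (ENNReal.ofReal_eq_ofReal_iff (norm_nonneg _)
      (tsum_nonneg fun i => norm_nonneg _)).1 h4
  have hi' := eq_norm_mul_of_norm_tsum_eq hsumm hn i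
  have hd : deriv (Function.invFunOn f (O i)) y ≠ 0 := by
    rw [← inverseBranch_const]
    exact hF.deriv_inverseBranch_ne_zero (by rw [branchDomain_const]; exact ⟨x, hi, rfl⟩)
  have hai : a i = Complex.exp (Complex.I * b * τ x) * g x *
      |deriv (Function.invFunOn f (O i)) y| := by
    rw [ha]
    simp only
    rw [indicator_of_mem (show y ∈ f '' O i from ⟨x, hi, rfl⟩), hy, hF.invFunOn_apply hi]
  have hexp : ‖Complex.exp (Complex.I * b * τ x)‖ = 1 := by
    rw [mul_assoc, mul_comm Complex.I, ← Complex.ofReal_mul, Complex.norm_exp_ofReal_mul_I]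
  have hain : ‖a i‖ = ‖g x‖ * |deriv (Function.invFunOn f (O i)) y| := by
    rw [hai, norm_mul, norm_mul, hexp, one_mul, Complex.norm_real, Real.norm_eq_abs, abs_abs]
  have hg0 : g x ≠ 0 := fun h0 => hgx (by rw [phase, h0, zero_div])
  have hg0' : (‖g x‖ : ℂ) ≠ 0 := by exact_mod_cast norm_ne_zero_iff.2 hg0
  have hd' : ((|deriv (Function.invFunOn f (O i)) y| : ℝ) : ℂ) ≠ 0 := by
    exact_mod_cast abs_ne_zero.2 hd
  rw [hS, hain, hai, norm_mul, hz, one_mul, Complex.ofReal_mul] at hi'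
  rw [phase, phase, mul_div_assoc', mul_div_assoc', div_eq_iff hg0']
  refine mul_right_cancel₀ hd' (hi'.trans ?_)
  ring

theorem ae_phase_iterate_eq : ∀ᵐ x ∂circleMeasure, ∀ n : ℕ, phase g x ≠ 0 →
    Complex.exp (Complex.I * b * birkhoffSum f τ n x) * phase g x = z ^ n * phase g (f^[n] x) := by
  have h := hF.ae_phase_eq hz hg hgi htr
  filter_upwards [ae_all_iff.2 (hF.ae_comp_iterate h)] with x hx n h0
  induction n with
  | zero => simp [birkhoffSum_zero]
  | succ n ih =>
    -- The equation itself keeps a nonzero phase from vanishing later along the orbit.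
    have hne : phase g (f^[n] x) ≠ 0 := fun h1 => by
      rw [h1, mul_zero] at ih
      exact mul_ne_zero (Complex.exp_ne_zero _) h0 ih
    rw [birkhoffSum_succ, Complex.ofReal_add, mul_add, Complex.exp_add,
      mul_right_comm, ih, pow_succ, mul_right_comm, mul_assoc,
      hx n hne, ← Function.iterate_succ_apply' f, mul_assoc]

end Eigenfunction

end IsExpandingSkewProduct

end Measure

/-! ### Boundary layers, and inverse branches defined on large balls. -/

/-- Quantitative absolute continuity: the density is split into an `L¹`-small part and a bounded
Hölder part. -/
theorem massMeasure_le {α : ℝ≥0} {B : Type*} [NormedAddCommGroup B] [NormedSpace ℂ B]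
    {J : B →ₗ[ℂ] Lp ℂ 1 circleMeasure} (hB : IsAdapted α J) (p : B) {ε : ℝ} (hε : 0 < ε)
    (A : Set ℝ) : massMeasure (J p) A ≤ ENNReal.ofReal (‖p‖ * ε) +
      ENNReal.ofReal (‖p‖ * ε ^ (-(1 + (α : ℝ)⁻¹))) * circleMeasure A := by
  obtain ⟨q, hq1, hq2⟩ := hB.approx p ε hε
  set M := ENNReal.ofReal (‖p‖ * ε ^ (-(1 + (α : ℝ)⁻¹)))
  have hM : ∀ x, ‖q x‖ₑ ≤ M := fun x =>
    (le_iSup (fun x => ‖q x‖ₑ) x).trans (le_add_self.trans hq2)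
  set A' := toMeasurable circleMeasure A
  have hA' : MeasurableSet A' := measurableSet_toMeasurable _ _
  calc massMeasure (J p) A ≤ massMeasure (J p) A' := measure_mono (subset_toMeasurable _ _)
    _ = ∫⁻ x in A', ‖J p x‖ₑ ∂circleMeasure := withDensity_apply _ hA'
    _ ≤ ∫⁻ x in A', (‖J p x - q x‖ₑ + M) ∂circleMeasure := by
        refine lintegral_mono fun x => ?_
        calc ‖J p x‖ₑ = ‖(J p x - q x) + q x‖ₑ := by rw [sub_add_cancel]
          _ ≤ ‖J p x - q x‖ₑ + ‖q x‖ₑ := enorm_add_le _ _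
          _ ≤ _ := by gcongr; exact hM _
    _ = ∫⁻ x in A', ‖J p x - q x‖ₑ ∂circleMeasure + M * circleMeasure A := by
        rw [lintegral_add_right _ measurable_const, setLIntegral_const, measure_toMeasurable]
    _ ≤ _ := by
        gcongr
        refine (setLIntegral_le_lintegral _ _).trans ?_
        rwa [← eLpNorm_one_eq_lintegral_enorm]

section

variable {ι : Type*} {α : ℝ≥0} {f τ : ℝ → ℝ} {O : ι → Set ℝ}

/-- The points whose image is within `ε` of the boundary of the image of their partition
element. -/
def badSet (f : ℝ → ℝ) (O : ι → Set ℝ) (ε : ℝ) : Set ℝ :=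
  {x | ∃ i, x ∈ O i ∧ ¬ Metric.ball (f x) ε ⊆ f '' O i}

/-- The points around whose `n`-th image a ball of radius `ρ` lies in the domain of the inverse
branch of `f^n`. -/
def goodSet (f : ℝ → ℝ) (O : ι → Set ℝ) (n : ℕ) (ρ : ℝ) : Set ℝ :=
  {x | ∃ w : Fin n → ι, x ∈ cylinder f O w ∧ Metric.ball (f^[n] x) ρ ⊆ branchDomain f O w}

/-- For an interval, the boundary layer lies in two segments of length `ε` at its ends. -/
theorem volume_boundary_layer_le {U : Set ℝ} (hU : U.OrdConnected) (hb : U ⊆ Ico 0 1) {ε : ℝ} :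
    ∃ E : Set ℝ, MeasurableSet E ∧ volume E ≤ ENNReal.ofReal (2 * ε) ∧
      ∀ y ∈ U, ¬ Metric.ball y ε ⊆ U → y ∈ E := by
  rcases le_or_gt ε 0 with hε0 | hε0
  · refine ⟨∅, MeasurableSet.empty, by simp, fun y _ h => (h ?_).elim⟩
    rw [Metric.ball_eq_empty.2 hε0]; exact empty_subset _
  have hba : BddAbove U := bddAbove_Ico.mono hb
  have hbb : BddBelow U := bddBelow_Ico.mono hb
  refine ⟨Icc (sInf U) (sInf U + ε) ∪ Icc (sSup U - ε) (sSup U),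
    measurableSet_Icc.union measurableSet_Icc, ?_, fun y hy hyb => ?_⟩
  · refine (measure_union_le _ _).trans ?_
    rw [Real.volume_Icc, Real.volume_Icc, add_sub_cancel_left, sub_sub_cancel, two_mul,
      ENNReal.ofReal_add hε0.le hε0.le]
  · by_contra hcon
    rw [mem_union, not_or] at hcon
    have h1 : sInf U + ε < y := by
      by_contra h
      exact hcon.1 ⟨csInf_le hbb hy, not_lt.1 h⟩
    have h2 : y < sSup U - ε := by
      by_contra h
      exact hcon.2 ⟨not_lt.1 h, le_csSup hba hy⟩
    refine hyb (Subset.trans ?_ (IsConnected.Ioo_csInf_csSup_subset ⟨⟨y, hy⟩, hU.isPreconnected⟩ hbb hba))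
    rw [Real.ball_eq_Ioo]
    exact Ioo_subset_Ioo (by linarith) (by linarith)

namespace IsExpandingSkewProduct

theorem tsum_iSup_deriv_lt_top (hF : IsExpandingSkewProduct α f τ O) :
    ∑' i, ⨆ x ∈ f '' O i, ‖deriv (Function.invFunOn f (O i)) x‖ₑ < ⊤ := by
  have h := hF.summability 1 le_rfl
  rw [← (Equiv.funUnique (Fin 1) ι).symm.tsum_eq] at h
  convert h using 4 with i
  have : (Equiv.funUnique (Fin 1) ι).symm i = fun _ : Fin 1 => i := rfl
  rw [this, branchDomain_const, inverseBranch_const]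

/-- Each branch pulls a layer of measure at most `2ε` back with Jacobian at most `sup |h'|`, and
these suprema are summable. -/
theorem circleMeasure_badSet_le [Countable ι] (hF : IsExpandingSkewProduct α f τ O) (ε : ℝ) :
    circleMeasure (badSet f O ε) ≤ ENNReal.ofReal (2 * ε) *
      ∑' i, ⨆ x ∈ f '' O i, ‖deriv (Function.invFunOn f (O i)) x‖ₑ := by
  have hsub : badSet f O ε ⊆ ⋃ i, {x ∈ O i | ¬ Metric.ball (f x) ε ⊆ f '' O i} :=
    fun x ⟨i, hi⟩ => mem_iUnion.2 ⟨i, hi⟩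
  refine (Measure.restrict_apply_le _ _).trans ((measure_mono hsub).trans
    ((measure_iUnion_le _).trans ?_))
  rw [← ENNReal.tsum_mul_left]
  refine ENNReal.tsum_le_tsum fun i => ?_
  have hoc : (f '' O i).OrdConnected := by
    rw [← branchDomain_const]; exact hF.ordConnected_branchDomain _
  obtain ⟨E, hE, hvol, hmem⟩ := volume_boundary_layer_le hoc (hF.image_subset_Ico i) (ε := ε)
  have hE' : MeasurableSet (E ∩ f '' O i) := hE.inter (hF.isOpen_image i).measurableSet
  have hinj : InjOn (Function.invFunOn f (O i)) (E ∩ f '' O i) := by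
    rintro _ ⟨-, ⟨s, hs, rfl⟩⟩ _ ⟨-, ⟨t, ht, rfl⟩⟩ h
    rw [hF.invFunOn_apply hs, hF.invFunOn_apply ht] at h
    rw [h]
  calc volume {x ∈ O i | ¬ Metric.ball (f x) ε ⊆ f '' O i}
      ≤ volume (Function.invFunOn f (O i) '' (E ∩ f '' O i)) := by
        refine measure_mono ?_
        rintro x ⟨hx, hxb⟩
        exact ⟨f x, ⟨hmem _ ⟨x, hx, rfl⟩ hxb, x, hx, rfl⟩, hF.invFunOn_apply hx⟩
    _ = ∫⁻ x in E ∩ f '' O i, ENNReal.ofReal |deriv (Function.invFunOn f (O i)) x| := by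
        have := lintegral_image_eq_lintegral_abs_deriv_mul hE'
          (fun y hy => (hF.hasDerivAt_invFunOn hy.2).hasDerivWithinAt) hinj (fun _ => 1)
        simpa using this
    _ ≤ ∫⁻ x in E ∩ f '' O i, ⨆ x ∈ f '' O i, ‖deriv (Function.invFunOn f (O i)) x‖ₑ := by
        refine setLIntegral_mono' hE' fun x hx => ?_
        rw [← Real.enorm_eq_ofReal_abs]
        exact le_iSup₂ (f := fun x (_ : x ∈ f '' O i) =>
          ‖deriv (Function.invFunOn f (O i)) x‖ₑ) x hx.2
    _ = (⨆ x ∈ f '' O i, ‖deriv (Function.invFunOn f (O i)) x‖ₑ) * volume (E ∩ f '' O i) :=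
        setLIntegral_const _ _
    _ ≤ _ := by
        rw [mul_comm]
        gcongr
        exact (measure_mono inter_subset_left).trans hvol

/-- The measure with a density from `B` of the `t`-bad set is at most a power of `t`. -/
theorem exists_massMeasure_badSet_le [Countable ι] (hF : IsExpandingSkewProduct α f τ O)
    (hα : 0 < α) {B : Type*} [NormedAddCommGroup B] [NormedSpace ℂ B]
    {J : B →ₗ[ℂ] Lp ℂ 1 circleMeasure} (hB : IsAdapted α J) (p : B) :
    ∃ κ C : ℝ, 0 < κ ∧ 0 ≤ C ∧ ∀ t : ℝ, 0 < t →
      massMeasure (J p) (badSet f O t) ≤ ENNReal.ofReal (C * t ^ κ) := by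
  have hα' : (0 : ℝ) < α := by exact_mod_cast hα
  set S := ∑' i, ⨆ x ∈ f '' O i, ‖deriv (Function.invFunOn f (O i)) x‖ₑ with hS
  obtain ⟨S', hS'0, hS'⟩ : ∃ s : ℝ, 0 ≤ s ∧ S = ENNReal.ofReal s :=
    ⟨S.toReal, ENNReal.toReal_nonneg,
      (ENNReal.ofReal_toReal hF.tsum_iSup_deriv_lt_top.ne).symm⟩
  -- This exponent balances the two errors: for `ε = t^κ` one has `ε^{-(1+1/α)} t = ε`.
  set κ : ℝ := (2 + (α : ℝ)⁻¹)⁻¹ with hκ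
  have hκ0 : 0 < κ := by positivity
  refine ⟨κ, ‖p‖ * (1 + 2 * S'), hκ0, by positivity, fun t ht => ?_⟩
  have h1 := massMeasure_le hB p (Real.rpow_pos_of_pos ht κ) (badSet f O t)
  refine h1.trans ((add_le_add le_rfl (mul_le_mul_right (hF.circleMeasure_badSet_le t) _)).trans ?_)
  rw [← hS, hS', ← ENNReal.ofReal_mul (by positivity),
    ← ENNReal.ofReal_mul (by positivity), ← ENNReal.ofReal_add (by positivity) (by positivity)]
  refine ENNReal.ofReal_le_ofReal (le_of_eq ?_)
  have h2 : (t ^ κ) ^ (-(1 + (α : ℝ)⁻¹)) * t = t ^ κ := by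
    rw [← Real.rpow_mul ht.le, ← Real.rpow_add_one ht.ne']
    congr 1
    rw [hκ]
    field_simp
    ring
  linear_combination (‖p‖ * 2 * S') * h2

/-- Pulling a ball back one step shrinks its radius by `exp (-hF.rate)`. At time `k`, with `n - 1 -
k` later steps already pulled back, only a correspondingly smaller neighbourhood of the boundary
must be avoided. -/
theorem mem_goodSet (hF : IsExpandingSkewProduct α f τ O) {x : ℝ} (hx : x ∈ regularSet f O) :
    ∀ (n : ℕ) {ρ : ℝ}, 0 < ρ →
      (∀ k < n, f^[k] x ∉ badSet f O (ρ * Real.exp (-hF.rate) ^ (n - 1 - k))) →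
      x ∈ goodSet f O n ρ
  | 0, ρ, _, _ => ⟨Fin.elim0, by simp [cylinder_zero, branchDomain]⟩
  | n + 1, ρ, hρ, h => by
    have he : 0 < Real.exp (-hF.rate) := Real.exp_pos _
    obtain ⟨w, hxw, hball⟩ := hF.mem_goodSet hx n (ρ := ρ * Real.exp (-hF.rate)) (by positivity) (by
      intro k hk
      have := h k (by omega)
      rwa [show n + 1 - 1 - k = (n - 1 - k) + 1 by omega, pow_succ', ← mul_assoc] at this)
    obtain ⟨i, hi⟩ := hx n
    have hb : Metric.ball (f^[n + 1] x) ρ ⊆ f '' O i := by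
      by_contra hcon
      refine h n (Nat.lt_succ_self n) ⟨i, hi, ?_⟩
      rw [Nat.add_sub_cancel, Nat.sub_self, pow_zero, mul_one, ← Function.iterate_succ_apply' f]
      exact hcon
    have hcyl : cylinder f O (Fin.snoc w i : Fin (n + 1) → ι) =
        cylinder f O w ∩ f^[n] ⁻¹' O i := by
      rw [cylinder_succ]; simp
    refine ⟨Fin.snoc w i, ?_, ?_⟩
    · rw [hcyl]
      exact ⟨hxw, hi⟩
    · rintro y hy
      obtain ⟨y', hy', rfl⟩ := hb hy
      have hexp : |y' - f^[n] x| ≤ Real.exp (-hF.rate) * |f y' - f (f^[n] x)| := by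
        have := hF.expansion (w := fun _ : Fin 1 => i) (x := y') (y := f^[n] x)
          (by rwa [cylinder_const]) (by rwa [cylinder_const])
        simpa using this
      rw [Metric.mem_ball, Function.iterate_succ_apply', Real.dist_eq] at hy
      have hy'b : y' ∈ Metric.ball (f^[n] x) (ρ * Real.exp (-hF.rate)) := by
        rw [Metric.mem_ball, Real.dist_eq, mul_comm ρ]
        exact hexp.trans_lt (mul_lt_mul_of_pos_left hy he)
      obtain ⟨y'', hy'', rfl⟩ := hball hy'b
      refine ⟨y'', ?_, Function.iterate_succ_apply' _ _ _⟩
      rw [hcyl]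
      exact ⟨hy'', hy'⟩

section Eigenfunction

variable [Countable ι] {b : ℝ} {z : ℂ}

/-- An inequality suffices and allows arbitrary `A`: invariance is applied to a measurable hull. -/
theorem massMeasure_preimage_le {g : ℝ → ℂ} (hg : Measurable g)
    (hgi : ∫⁻ x, ‖g x‖ₑ ∂circleMeasure ≠ ⊤)
    (htr : transfer f τ O b g =ᵐ[circleMeasure] fun x => z * g x)
    (hF : IsExpandingSkewProduct α f τ O) (hz : ‖z‖ = 1) (A : Set ℝ) :
    ∀ n : ℕ, massMeasure g (f^[n] ⁻¹' A) ≤ massMeasure g A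
  | 0 => le_rfl
  | n + 1 => by
    rw [Function.iterate_succ, preimage_comp]
    refine le_trans ?_ (massMeasure_preimage_le hg hgi htr hF hz A n)
    rw [← measure_toMeasurable (μ := massMeasure g) (f^[n] ⁻¹' A),
      ← hF.massMeasure_preimage hz hg hgi htr (measurableSet_toMeasurable _ _)]
    exact measure_mono (preimage_mono (subset_toMeasurable _ _))

/-- With positive probability, the inverse branches along an orbit are infinitely often defined on
balls of a fixed radius. -/
theorem exists_frequently_mem_goodSet (hF : IsExpandingSkewProduct α f τ O) (hz : ‖z‖ = 1)
    (hα : 0 < α) {B : Type*} [NormedAddCommGroup B] [NormedSpace ℂ B]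
    {J : B →ₗ[ℂ] Lp ℂ 1 circleMeasure} (hB : IsAdapted α J) {p : B}
    (hg : Measurable (J p)) (hgi : ∫⁻ x, ‖J p x‖ₑ ∂circleMeasure ≠ ⊤)
    (hg0 : ∫⁻ x, ‖J p x‖ₑ ∂circleMeasure ≠ 0)
    (htr : transfer f τ O b (J p) =ᵐ[circleMeasure] fun x => z * J p x) :
    ∃ ρ : ℝ, 0 < ρ ∧ ∃ᶠ x in ae (massMeasure (J p)), ∃ᶠ n in atTop, x ∈ goodSet f O n ρ := by
  obtain ⟨κ, C, hκ, hC, hbad⟩ := hF.exists_massMeasure_badSet_le hα hB p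
  set ν := massMeasure (J p) with hν
  have huniv : ν univ = ∫⁻ x, ‖J p x‖ₑ ∂circleMeasure := by
    rw [hν, massMeasure, withDensity_apply _ MeasurableSet.univ, Measure.restrict_univ]
  have hr : Real.exp (-hF.rate) ^ κ < 1 :=
    Real.rpow_lt_one (Real.exp_pos _).le (Real.exp_lt_one_iff.2 (neg_lt_zero.2 hF.rate_pos)) hκ
  set r := Real.exp (-hF.rate) ^ κ with hrdef
  have hr0 : 0 ≤ r := by positivity
  -- By invariance the bad events at times `k < n` have geometrically decaying mass, so the union
  -- bound is uniform in `n` and tends to zero with `ρ`.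
  have hbound : ∀ ρ : ℝ, 0 < ρ → ∀ n,
      ν (goodSet f O n ρ)ᶜ ≤ ENNReal.ofReal (C * (1 - r)⁻¹ * ρ ^ κ) := by
    intro ρ hρ n
    have hsub : (goodSet f O n ρ)ᶜ ⊆ (regularSet f O)ᶜ ∪ ⋃ k ∈ Finset.range n,
        f^[k] ⁻¹' badSet f O (ρ * Real.exp (-hF.rate) ^ (n - 1 - k)) := by
      intro x hx
      by_contra hcon
      simp only [mem_union, mem_compl_iff, not_or, not_not, mem_iUnion, Finset.mem_range,
        mem_preimage, not_exists] at hcon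
      exact hx (hF.mem_goodSet hcon.1 n hρ hcon.2)
    have hreg : ν (regularSet f O)ᶜ = 0 :=
      (withDensity_absolutelyContinuous circleMeasure _).ae_le hF.ae_mem_regularSet
    calc ν (goodSet f O n ρ)ᶜ ≤ ν (regularSet f O)ᶜ + ∑ k ∈ Finset.range n,
          ν (f^[k] ⁻¹' badSet f O (ρ * Real.exp (-hF.rate) ^ (n - 1 - k))) :=
          (measure_mono hsub).trans ((measure_union_le _ _).trans
            (add_le_add le_rfl (measure_biUnion_finset_le _ _)))
      _ ≤ ∑ k ∈ Finset.range n, ENNReal.ofReal (C * ρ ^ κ * r ^ (n - 1 - k)) := by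
          rw [hreg, zero_add]
          refine Finset.sum_le_sum fun k _ => ?_
          refine (massMeasure_preimage_le hg hgi htr hF hz _ k).trans
            ((hbad _ (by positivity)).trans (le_of_eq ?_))
          rw [Real.mul_rpow hρ.le (by positivity), ← Real.rpow_natCast,
            ← Real.rpow_natCast, hrdef, ← Real.rpow_mul (Real.exp_pos _).le,
            ← Real.rpow_mul (Real.exp_pos _).le, mul_comm κ, mul_assoc]
      _ = ENNReal.ofReal (C * ρ ^ κ * ∑ j ∈ Finset.range n, r ^ j) := by
          rw [← ENNReal.ofReal_sum_of_nonneg fun k _ => by positivity, ← Finset.mul_sum,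
            Finset.sum_range_reflect (fun j => r ^ j) n]
      _ ≤ _ := by
          refine ENNReal.ofReal_le_ofReal ?_
          rw [mul_right_comm]
          gcongr
          rw [← tsum_geometric_of_lt_one hr0 hr]
          exact (summable_geometric_of_lt_one hr0 hr).sum_le_tsum _ fun _ _ => by positivity
  obtain ⟨ρ, hρ, hρ2⟩ : ∃ ρ : ℝ, 0 < ρ ∧
      ENNReal.ofReal (C * (1 - r)⁻¹ * ρ ^ κ) < ν univ := by
    have ht : Tendsto (fun ρ : ℝ => ENNReal.ofReal (C * (1 - r)⁻¹ * ρ ^ κ)) (𝓝[>] 0) (𝓝 0) := by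
      have h1 : Tendsto (fun ρ : ℝ => C * (1 - r)⁻¹ * ρ ^ κ) (𝓝 0)
          (𝓝 (C * (1 - r)⁻¹ * 0 ^ κ)) :=
        ((Real.continuousAt_rpow_const 0 κ (Or.inr hκ.le)).tendsto).const_mul _
      rw [Real.zero_rpow hκ.ne', mul_zero] at h1
      simpa using (ENNReal.tendsto_ofReal h1).mono_left nhdsWithin_le_nhds
    have h2 := ht.eventually (gt_mem_nhds (show 0 < ν univ by
      rw [huniv]; exact pos_iff_ne_zero.2 hg0))
    obtain ⟨ρ, h3, h4⟩ := (h2.and self_mem_nhdsWithin).exists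
    exact ⟨ρ, h4, h3⟩
  refine ⟨ρ, hρ, fun hcon => ?_⟩
  -- If almost every point were good only finitely often, this increasing union would have full
  -- mass, while each of its members has mass below a bound smaller than the total.
  have hev : ∀ᵐ x ∂ν, x ∈ ⋃ N : ℕ, ⋂ n ≥ N, (goodSet f O n ρ)ᶜ := by
    filter_upwards [hcon] with x hx
    rw [not_frequently, eventually_atTop] at hx
    obtain ⟨N, hN⟩ := hx
    exact mem_iUnion.2 ⟨N, mem_iInter₂.2 hN⟩
  have hmono : Monotone fun N : ℕ => ⋂ n ≥ N, (goodSet f O n ρ)ᶜ := fun N M hNM =>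
    biInter_subset_biInter_left fun n (hn : M ≤ n) => hNM.trans hn
  have hle : ν (⋃ N : ℕ, ⋂ n ≥ N, (goodSet f O n ρ)ᶜ) ≤
      ENNReal.ofReal (C * (1 - r)⁻¹ * ρ ^ κ) := by
    rw [hmono.measure_iUnion]
    exact iSup_le fun N => (measure_mono (biInter_subset_of_mem (le_refl N))).trans
      (hbound ρ hρ N)
  have : ν univ ≤ ν (⋃ N : ℕ, ⋂ n ≥ N, (goodSet f O n ρ)ᶜ) :=
    measure_mono_ae (hev.mono fun x hx _ => hx)
  exact absurd hρ2 (not_lt.2 (this.trans hle))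

end Eigenfunction

end IsExpandingSkewProduct

end

/-! ### Lipschitz regularity of the phase. -/

theorem norm_exp_I_mul (b t : ℝ) : ‖Complex.exp (Complex.I * b * t)‖ = 1 := by
  rw [mul_assoc, mul_comm Complex.I, ← Complex.ofReal_mul, Complex.norm_exp_ofReal_mul_I]

theorem norm_exp_sub_exp_le (b s t : ℝ) :
    ‖Complex.exp (Complex.I * b * s) - Complex.exp (Complex.I * b * t)‖ ≤ |b| * |s - t| := by
  have h1 : Complex.exp (Complex.I * b * s) - Complex.exp (Complex.I * b * t) =
      Complex.exp (Complex.I * b * t) * (Complex.exp (Complex.I * ((b * (s - t) : ℝ) : ℂ)) - 1) := by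
    rw [mul_sub, ← Complex.exp_add, mul_one]
    congr 2
    push_cast; ring
  rw [h1, norm_mul, norm_exp_I_mul, one_mul, ← abs_mul]
  exact Real.norm_exp_I_mul_ofReal_sub_one_le

/-- On a subset of full measure of `V`, the function `u` is `K`-Lipschitz and of modulus one. -/
def IsLipschitzPhaseOn (u : ℝ → ℂ) (K : ℝ≥0) (V : Set ℝ) : Prop :=
  ∃ G : Set ℝ, (∀ᵐ y, y ∈ V → y ∈ G) ∧ (∀ y ∈ G, ‖u y‖ = 1) ∧ LipschitzOnWith K u G

section

variable {ι : Type*} {α : ℝ≥0} {f τ : ℝ → ℝ} {O : ι → Set ℝ}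

namespace IsExpandingSkewProduct

theorem cylinder_subset_Ico (hF : IsExpandingSkewProduct α f τ O) {n : ℕ} (hn : 1 ≤ n)
    (w : Fin n → ι) : cylinder f O w ⊆ Ico 0 1 :=
  fun _ hx => hF.subset_Ico _ (hx ⟨0, hn⟩)

theorem branchDomain_subset_Ico (hF : IsExpandingSkewProduct α f τ O) {n : ℕ} (hn : 1 ≤ n)
    (w : Fin n → ι) : branchDomain f O w ⊆ Ico 0 1 :=
  (image_mono (hF.cylinder_subset_Ico hn w)).trans (hF.mapsTo_iterate n).image_subset

theorem ae_inverseBranch (hF : IsExpandingSkewProduct α f τ O) {n : ℕ} {w : Fin n → ι}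
    {U : Set ℝ} (hU : U ⊆ cylinder f O w) {P : ℝ → Prop} (h : ∀ᵐ x, x ∈ U → P x) :
    ∀ᵐ y, y ∈ f^[n] '' U → P (inverseBranch f O w y) := by
  refine measure_mono_null ?_ (hF.volume_image_iterate_eq_zero (w := w)
    (s := U ∩ {x | ¬ (x ∈ U → P x)}) (inter_subset_left.trans hU)
    (measure_mono_null inter_subset_right h))
  intro y hy
  simp only [mem_compl_iff, mem_ofPred_eq, Classical.not_imp] at hy
  obtain ⟨⟨x, hx, rfl⟩, hP⟩ := hy
  rw [hF.inverseBranch_iterate (hU hx)] at hP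
  exact ⟨x, ⟨hx, fun h => hP (h hx)⟩, rfl⟩

/-- A distortion constant of the inverse branches. -/
def distortionConst (hF : IsExpandingSkewProduct α f τ O) : ℝ := hF.distortion.choose

theorem abs_deriv_inverseBranch_le_mul (hF : IsExpandingSkewProduct α f τ O) {n : ℕ}
    (hn : 1 ≤ n) {w : Fin n → ι} {x y : ℝ} (hx : x ∈ branchDomain f O w)
    (hy : y ∈ branchDomain f O w) : |deriv (inverseBranch f O w) x| ≤
      Real.exp hF.distortionConst * |deriv (inverseBranch f O w) y| := by
  have h := hF.distortion.choose_spec.2 n hn w x hx y hy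
  rw [div_le_iff₀ (abs_pos.2 (hF.deriv_inverseBranch_ne_zero hy))] at h
  refine h.trans (mul_le_mul_of_nonneg_right (Real.exp_le_exp.2 ?_) (abs_nonneg _))
  refine mul_le_of_le_one_right hF.distortion.choose_spec.1 ?_
  have hx' := hF.branchDomain_subset_Ico hn w hx
  have hy' := hF.branchDomain_subset_Ico hn w hy
  refine Real.rpow_le_one (abs_nonneg _) ?_ α.2
  rw [abs_le]
  constructor <;> linarith [hx'.1, hx'.2, hy'.1, hy'.2]

/-- By bounded distortion, the mean oscillation of `u ∘ h` on a ball is controlled by that of `u`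
on a ball of comparable size to the image. -/
theorem exists_lintegral_inverseBranch_le (hF : IsExpandingSkewProduct α f τ O) {n : ℕ}
    (hn : 1 ≤ n) {w : Fin n → ι} {x ρ : ℝ} (hx : x ∈ cylinder f O w) (hρ : 0 < ρ)
    (hball : Metric.ball (f^[n] x) ρ ⊆ branchDomain f O w) {u : ℝ → ℂ} (hu : Measurable u)
    (hu1 : ∀ x, ‖u x‖ ≤ 1) :
    ∃ δ : ℝ, 0 < δ ∧ δ ≤ Real.exp (-hF.rate * n) * (Real.exp hF.distortionConst * ρ) ∧
      ∫⁻ y in Metric.ball (f^[n] x) ρ, ‖u (inverseBranch f O w y) - u x‖ₑ ≤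
        ENNReal.ofReal (2 * Real.exp hF.distortionConst ^ 2 * ρ *
          ⨍ y in Metric.closedBall x δ, ‖u y - u x‖) := by
  set h := inverseBranch f O w with hh
  set E := Real.exp hF.distortionConst with hE
  have hE0 : 0 < E := Real.exp_pos _
  have hfx : f^[n] x ∈ branchDomain f O w := ⟨x, hx, rfl⟩
  set s := |deriv h (f^[n] x)| with hs
  have hs0 : 0 < s := abs_pos.2 (hF.deriv_inverseBranch_ne_zero hfx)
  have hδ : 0 < s * (E * ρ) := by positivity
  -- Distortion gives `|h'| ≤ E s` on the ball, whence this radius, and `1 ≤ (E/s) |h'|`, whence the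
  -- Jacobian can be inserted. The final constant is `(E/s) · 2 s E ρ = 2 E² ρ`.
  refine ⟨s * (E * ρ), hδ, ?_, ?_⟩
  · gcongr
    exact hF.abs_deriv_inverseBranch_le hfx
  have hder : ∀ y ∈ Metric.ball (f^[n] x) ρ, HasDerivAt h (deriv h y) y := fun y hy =>
    (hF.hasDerivAt_inverseBranch (hball hy)).differentiableAt.hasDerivAt
  have hsub : h '' Metric.ball (f^[n] x) ρ ⊆ Metric.closedBall x (s * (E * ρ)) := by
    rintro _ ⟨y, hy, rfl⟩
    have h1 := (convex_ball (f^[n] x) ρ).norm_image_sub_le_of_norm_deriv_le (f := h)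
      (C := E * s) (fun t ht => (hder t ht).differentiableAt)
      (fun t ht => hF.abs_deriv_inverseBranch_le_mul hn (hball ht) hfx)
      (Metric.mem_ball_self hρ) hy
    rw [hh, hF.inverseBranch_iterate hx, ← hh] at h1
    rw [Metric.mem_closedBall, Real.dist_eq]
    refine h1.trans ?_
    rw [mul_comm E, mul_assoc]
    gcongr
    exact (Metric.mem_ball.1 hy).le
  have hinj : InjOn h (Metric.ball (f^[n] x) ρ) := fun s hs t ht hst => by
    rw [← iterate_inverseBranch (hball hs), ← hh, hst, hh, iterate_inverseBranch (hball ht)]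
  have hint : IntegrableOn (fun y => ‖u y - u x‖) (Metric.closedBall x (s * (E * ρ))) := by
    refine Measure.integrableOn_of_bounded (M := 2) measure_closedBall_lt_top.ne
      (hu.sub_const _).norm.aestronglyMeasurable (Eventually.of_forall fun y => ?_)
    rw [norm_norm]
    calc ‖u y - u x‖ ≤ ‖u y‖ + ‖u x‖ := norm_sub_le _ _
      _ ≤ 2 := by linarith [hu1 y, hu1 x]
  calc ∫⁻ y in Metric.ball (f^[n] x) ρ, ‖u (h y) - u x‖ₑ
      ≤ ∫⁻ y in Metric.ball (f^[n] x) ρ, ENNReal.ofReal (E / s) *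
          (ENNReal.ofReal |deriv h y| * ‖u (h y) - u x‖ₑ) := by
        refine setLIntegral_mono' measurableSet_ball fun y hy => ?_
        rw [← mul_assoc, ← ENNReal.ofReal_mul (by positivity)]
        refine le_mul_of_one_le_left' ?_
        rw [ENNReal.one_le_ofReal, div_mul_eq_mul_div, le_div_iff₀ hs0, one_mul]
        exact hF.abs_deriv_inverseBranch_le_mul hn hfx (hball hy)
    _ = ENNReal.ofReal (E / s) * ∫⁻ y in h '' Metric.ball (f^[n] x) ρ, ‖u y - u x‖ₑ := by
        rw [lintegral_const_mul' _ _ ENNReal.ofReal_ne_top,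
          ← lintegral_image_eq_lintegral_abs_deriv_mul measurableSet_ball
            (fun y hy => (hder y hy).hasDerivWithinAt) hinj (fun y => ‖u y - u x‖ₑ)]
    _ ≤ ENNReal.ofReal (E / s) * ∫⁻ y in Metric.closedBall x (s * (E * ρ)), ‖u y - u x‖ₑ := by
        gcongr
    _ = ENNReal.ofReal (E / s) *
          ENNReal.ofReal (∫ y in Metric.closedBall x (s * (E * ρ)), ‖u y - u x‖) := by
        rw [ofReal_integral_eq_lintegral_ofReal hint
          (Eventually.of_forall fun y => norm_nonneg _)]
        simp_rw [ofReal_norm]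
    _ = _ := by
        rw [← ENNReal.ofReal_mul (by positivity), setAverage_eq, Real.volume_real_closedBall hδ.le,
          smul_eq_mul]
        congr 1
        field_simp

section Eigenfunction

variable [Countable ι] (hF : IsExpandingSkewProduct α f τ O) {b : ℝ} {z : ℂ} (hz : ‖z‖ = 1)
  {u : ℝ → ℂ} (hu : Measurable u) (hu1 : ∀ x, ‖u x‖ ≤ 1) (hu2 : ∀ x, u x ≠ 0 → ‖u x‖ = 1)
  (heq : ∀ᵐ x ∂circleMeasure, ∀ n : ℕ, u x ≠ 0 →
    Complex.exp (Complex.I * b * birkhoffSum f τ n x) * u x = z ^ n * u (f^[n] x))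

/-- The function on the domain of the inverse branch `h` that `u` has to be close to if `u ∘ h` is
close to a constant `c`. -/
def branchPhase (f τ : ℝ → ℝ) (O : ι → Set ℝ) (b : ℝ) (z c : ℂ) {n : ℕ} (w : Fin n → ι) (y : ℝ) :
    ℂ := (z ^ n)⁻¹ * (Complex.exp (Complex.I * b * birkhoffSum f τ n (inverseBranch f O w y)) * c)

omit [Countable ι] in
include hF hz in
theorem norm_branchPhase_sub_le {c : ℂ} (hc : ‖c‖ = 1) {n : ℕ} {w : Fin n → ι} {y y' : ℝ}
    (hy : y ∈ branchDomain f O w) (hy' : y' ∈ branchDomain f O w) :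
    ‖branchPhase f τ O b z c w y - branchPhase f τ O b z c w y'‖ ≤
      |b| * hF.fibreConst * |y - y'| := by
  rw [branchPhase, branchPhase, ← mul_sub, ← sub_mul, norm_mul, norm_mul, norm_inv, norm_pow, hz,
    one_pow, inv_one, one_mul, hc, mul_one, mul_assoc |b|]
  exact (norm_exp_sub_exp_le _ _ _).trans
    (mul_le_mul_of_nonneg_left (hF.abs_birkhoffSum_inverseBranch_sub_le hy hy') (abs_nonneg _))

omit [Countable ι] in
include hz in
theorem norm_branchPhase {c : ℂ} (hc : ‖c‖ = 1) {n : ℕ} (w : Fin n → ι) (y : ℝ) :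
    ‖branchPhase f τ O b z c w y‖ = 1 := by
  rw [branchPhase, norm_mul, norm_mul, norm_inv, norm_pow, hz, one_pow, inv_one, one_mul, hc,
    norm_exp_I_mul, mul_one]

-- Where `u ∘ h ≠ 0` the phase equation gives equality with constant 1. Where `u ∘ h` vanishes, the
-- left side is at most 2 and `‖0 - c‖ = 1`, which accounts for the factor 2.
omit [Countable ι] in
include hF hz hu1 heq in
theorem ae_norm_sub_branchPhase_le {c : ℂ} (hc : ‖c‖ = 1) {n : ℕ} (hn : 1 ≤ n)
    (w : Fin n → ι) : ∀ᵐ y, y ∈ branchDomain f O w →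
      ‖u y - branchPhase f τ O b z c w y‖ ≤ 2 * ‖u (inverseBranch f O w y) - c‖ := by
  have hz0 : z ^ n ≠ 0 := pow_ne_zero _ fun h => by rw [h, norm_zero] at hz; exact zero_ne_one hz
  rw [ae_circleMeasure_iff] at heq
  have h1 := hF.ae_inverseBranch (w := w) Subset.rfl
    (heq.mono fun x hx hxw => hx (hF.cylinder_subset_Ico hn w hxw))
  filter_upwards [h1] with y hy hyw
  have h2 := hy hyw n
  rw [iterate_inverseBranch hyw] at h2
  set v := u (inverseBranch f O w y) with hv
  by_cases h0 : v = 0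
  · rw [h0, zero_sub, norm_neg, hc]
    calc ‖u y - branchPhase f τ O b z c w y‖ ≤ ‖u y‖ + ‖branchPhase f τ O b z c w y‖ :=
          norm_sub_le _ _
      _ ≤ 2 * 1 := by rw [norm_branchPhase hz hc]; linarith [hu1 y]
  · have h3 : u y = (z ^ n)⁻¹ *
        (Complex.exp (Complex.I * b * birkhoffSum f τ n (inverseBranch f O w y)) * v) := by
      rw [h2 h0, inv_mul_cancel_left₀ hz0]
    rw [h3, branchPhase, ← mul_sub, ← mul_sub, norm_mul, norm_mul, norm_inv, norm_pow, hz,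
      one_pow, inv_one, one_mul, norm_exp_I_mul, one_mul]
    linarith [norm_nonneg (v - c)]

omit [Countable ι] in
include hF hz hu hu1 hu2 heq in
/-- If the inverse branches along the orbit of a Lebesgue point of `u` are often defined on balls
of a fixed radius, then `u` is Lipschitz on an interval. -/
theorem exists_isLipschitzPhaseOn {ρ : ℝ} (hρ : 0 < ρ) {x : ℝ} (hx : x ∈ Ico (0 : ℝ) 1)
    (hux : u x ≠ 0) (hfreq : ∃ᶠ n in atTop, x ∈ goodSet f O n ρ)
    (hleb : Tendsto (fun δ => ⨍ y in Metric.closedBall x δ, ‖u y - u x‖) (𝓝[>] 0) (𝓝 0)) :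
    ∃ V : Set ℝ, IsOpen V ∧ V.Nonempty ∧ V ⊆ Ico 0 1 ∧
      IsLipschitzPhaseOn u (‖b‖₊ * hF.fibreConst) V := by
  have hc := hu2 x hux
  obtain ⟨φ, hφ, hgood⟩ := extraction_of_frequently_atTop
    (hfreq.and_eventually (eventually_ge_atTop 1))
  -- The balls have moving centres; compactness provides one ball `V` of half the radius inside all
  -- late ones.
  obtain ⟨y₀, -, ψ, hψ, hlim⟩ := isCompact_Icc.tendsto_subseq (x := fun k => f^[φ k] x)
    (fun k => Ico_subset_Icc_self (hF.mapsTo_iterate _ hx))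
  choose w hw hball using fun k => (hgood (ψ k)).1
  have hn : ∀ k, 1 ≤ φ (ψ k) := fun k => (hgood (ψ k)).2
  choose δ hδ0 hδ hδint using fun k =>
    hF.exists_lintegral_inverseBranch_le (hn k) (hw k) hρ (hball k) hu hu1
  set V := Metric.ball y₀ (ρ / 2) with hV
  have hVsub : ∀ᶠ k in atTop, V ⊆ Metric.ball (f^[φ (ψ k)] x) ρ := by
    filter_upwards [hlim.eventually (Metric.ball_mem_nhds y₀ (half_pos hρ))] with k hk
    refine Metric.ball_subset_ball' ?_
    have := Metric.mem_ball'.1 hk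
    simp only [Function.comp] at this
    linarith
  obtain ⟨N, hN⟩ := eventually_atTop.1 hVsub
  have hVd : ∀ k, V ⊆ branchDomain f O (w (k + N)) := fun k =>
    (hN _ (Nat.le_add_left N k)).trans (hball _)
  set Ψ : ℕ → ℝ → ℂ := fun k => branchPhase f τ O b z (u x) (w (k + N)) with hΨ
  have hLip : ∀ k, LipschitzOnWith (‖b‖₊ * hF.fibreConst) (Ψ k) V := fun k =>
    LipschitzOnWith.of_dist_le_mul fun s hs t ht => by
      rw [dist_eq_norm, Real.dist_eq, NNReal.coe_mul, coe_nnnorm, Real.norm_eq_abs]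
      exact hF.norm_branchPhase_sub_le hz hc (hVd k hs) (hVd k ht)
  have hδlim : Tendsto δ atTop (𝓝[>] 0) := by
    refine tendsto_nhdsWithin_iff.2 ⟨?_, Eventually.of_forall hδ0⟩
    refine squeeze_zero (fun k => (hδ0 k).le) hδ ?_
    have h1 : Tendsto (fun k => Real.exp (-hF.rate * (φ (ψ k) : ℕ))) atTop (𝓝 0) := by
      refine Real.tendsto_exp_atBot.comp ?_
      refine Tendsto.const_mul_atTop_of_neg (neg_lt_zero.2 hF.rate_pos) ?_
      exact tendsto_natCast_atTop_atTop.comp (hφ.comp hψ).tendsto_atTop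
    simpa using h1.mul_const (Real.exp hF.distortionConst * ρ)
  -- The mean oscillation of `u` over shrinking balls about the Lebesgue point `x` controls the `L¹`
  -- distance. An almost everywhere convergent subsequence then passes the uniform Lipschitz bound
  -- and modulus one to `u`.
  have hL1 : Tendsto (fun k => eLpNorm (Ψ k - u) 1 (volume.restrict V)) atTop (𝓝 0) := by
    have hb : Tendsto (fun k => 2 * ENNReal.ofReal (2 * Real.exp hF.distortionConst ^ 2 * ρ *
        ⨍ y in Metric.closedBall x (δ (k + N)), ‖u y - u x‖)) atTop (𝓝 0) := by
      have h1 := (hleb.comp (hδlim.comp (tendsto_add_atTop_nat N))).const_mul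
        (2 * Real.exp hF.distortionConst ^ 2 * ρ)
      rw [mul_zero] at h1
      have h2 := ENNReal.Tendsto.const_mul (a := 2) (ENNReal.tendsto_ofReal h1)
        (Or.inr ENNReal.ofNat_ne_top)
      simpa using h2
    refine tendsto_of_tendsto_of_tendsto_of_le_of_le tendsto_const_nhds hb
      (fun _ => zero_le) fun k => ?_
    rw [eLpNorm_one_eq_lintegral_enorm]
    refine le_trans ?_ (mul_le_mul_right (hδint (k + N)) 2)
    rw [← lintegral_const_mul' _ _ ENNReal.ofNat_ne_top]
    refine le_trans ?_ (lintegral_mono_set (hN (k + N) (Nat.le_add_left N k)))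
    refine lintegral_mono_ae ?_
    rw [ae_restrict_iff' Metric.isOpen_ball.measurableSet]
    filter_upwards [hF.ae_norm_sub_branchPhase_le hz hu1 heq hc (hn (k + N)) (w (k + N))]
      with y hy hyV
    have h3 := ENNReal.ofReal_le_ofReal (hy (hVd k hyV))
    rw [ENNReal.ofReal_mul zero_le_two, ofReal_norm, ofReal_norm] at h3
    rw [Pi.sub_apply, enorm_sub_rev]
    simpa using h3
  have hmeas := tendstoInMeasure_of_tendsto_eLpNorm one_ne_zero
    (fun k => (hLip k).continuousOn.aestronglyMeasurable Metric.isOpen_ball.measurableSet)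
    hu.aestronglyMeasurable hL1
  obtain ⟨ns, -, hns⟩ := hmeas.exists_seq_tendsto_ae
  rw [ae_restrict_iff' Metric.isOpen_ball.measurableSet] at hns
  refine ⟨V, Metric.isOpen_ball, ⟨y₀, Metric.mem_ball_self (half_pos hρ)⟩,
    (hVd 0).trans (hF.branchDomain_subset_Ico (hn _) _),
    {y ∈ V | Tendsto (fun i => Ψ (ns i) y) atTop (𝓝 (u y))}, ?_, ?_, ?_⟩
  · filter_upwards [hns] with y hy hyV using ⟨hyV, hy hyV⟩
  · rintro y ⟨-, hy⟩
    refine tendsto_nhds_unique hy.norm ?_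
    simp_rw [hΨ, norm_branchPhase hz hc]
    exact tendsto_const_nhds
  · refine LipschitzOnWith.of_dist_le_mul fun s hs t ht => ?_
    exact le_of_tendsto (hs.2.dist ht.2)
      (Eventually.of_forall fun i => (hLip (ns i)).dist_le_mul s hs.1 t ht.1)

include hF hz heq in
/-- A Lipschitz phase on one interval propagates to almost all of the circle. -/
theorem ae_exists_isLipschitzPhaseOn {K : ℝ≥0} {V : Set ℝ} (hV : IsOpen V) (hVne : V.Nonempty)
    (hV1 : V ⊆ Ico 0 1) (hK : IsLipschitzPhaseOn u K V) :
    ∀ᵐ y ∂circleMeasure, ∃ U : Set ℝ, IsOpen U ∧ y ∈ U ∧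
      IsLipschitzPhaseOn u (K + ‖b‖₊ * hF.fibreConst) U := by
  have hz0 : z ≠ 0 := fun h => by rw [h, norm_zero] at hz; exact zero_ne_one hz
  obtain ⟨x, hxV, hxr⟩ : ∃ x ∈ V, x ∈ regularSet f O := by
    by_contra hcon
    push Not at hcon
    refine (hV.measure_pos volume hVne).ne' (measure_mono_null ?_
      (hF.countable_diff_regularSet.measure_zero volume))
    exact fun x hx => ⟨hV1 hx, hcon x hx⟩
  obtain ⟨ε, hε, hball⟩ := Metric.isOpen_iff.1 hV x hxV
  choose w hw using hxr
  obtain ⟨n, hn, hnε⟩ : ∃ n : ℕ, 1 ≤ n ∧ Real.exp (-hF.rate * n) < ε := by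
    have h1 : Tendsto (fun n : ℕ => Real.exp (-hF.rate * n)) atTop (𝓝 0) :=
      Real.tendsto_exp_atBot.comp (Tendsto.const_mul_atTop_of_neg (neg_lt_zero.2 hF.rate_pos)
        tendsto_natCast_atTop_atTop)
    exact ((eventually_ge_atTop 1).and (h1.eventually (gt_mem_nhds hε))).exists
  set W := cylinder f O (fun k : Fin n => w k) with hWdef
  have hxW : x ∈ W := fun k => hw k
  -- A cylinder of length `n` has diameter at most `exp (-hF.rate * n) < ε`.
  have hWV : W ⊆ V := by
    intro y hy
    refine hball ?_
    rw [Metric.mem_ball, Real.dist_eq]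
    refine (hF.expansion hy hxW).trans_lt (lt_of_le_of_lt ?_ hnε)
    refine mul_le_of_le_one_right (Real.exp_pos _).le ?_
    have h1 := hF.mapsTo_iterate n (hV1 hxV)
    have h2 := hF.mapsTo_iterate n (hF.cylinder_subset_Ico hn _ hy)
    rw [abs_le]
    constructor <;> linarith [h1.1, h1.2, h2.1, h2.2]
  obtain ⟨N, hN⟩ := hF.covering n hn
  -- Images of nonregular points are discarded too, so every remaining `y` is `f^N t` with `t` in
  -- `W` having an itinerary, hence an inverse branch near `y`.
  have hcount := (hN _ ⟨x, hxW⟩).union (hF.countable_diff_regularSet.image f^[N])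
  obtain ⟨G, hG, hG1, hGL⟩ := hK
  rw [ae_circleMeasure_iff] at heq ⊢
  filter_upwards [hcount.ae_notMem volume] with y hy hy01
  rw [mem_union, not_or] at hy
  obtain ⟨t, ht, rfl⟩ : y ∈ f^[N] '' W := by
    by_contra h
    exact hy.1 ⟨hy01, h⟩
  have htr : t ∈ regularSet f O := by
    by_contra h
    exact hy.2 ⟨t, ⟨hV1 (hWV ht), h⟩, rfl⟩
  choose v hv using htr
  set w' : Fin N → ι := fun k => v k with hw'
  set U := W ∩ cylinder f O w' with hU
  have hUsub : U ⊆ cylinder f O w' := inter_subset_right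
  have hae : ∀ᵐ x, x ∈ U → x ∈ G ∧ Complex.exp (Complex.I * b * birkhoffSum f τ N x) * u x =
      z ^ N * u (f^[N] x) := by
    filter_upwards [hG, heq] with s hs hs' hsU
    have hsV := hWV hsU.1
    refine ⟨hs hsV, hs' (hV1 hsV) N fun h0 => ?_⟩
    have := hG1 s (hs hsV)
    rw [h0, norm_zero] at this
    exact zero_ne_one this
  have hmemd : ∀ s ∈ f^[N] '' U, s ∈ branchDomain f O w' := fun s hs => image_mono hUsub hs
  have hus : ∀ s ∈ f^[N] '' U, (Complex.exp (Complex.I * b *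
      birkhoffSum f τ N (inverseBranch f O w' s)) * u (inverseBranch f O w' s) =
      z ^ N * u (f^[N] (inverseBranch f O w' s))) → u s = (z ^ N)⁻¹ * (Complex.exp (Complex.I * b *
      birkhoffSum f τ N (inverseBranch f O w' s)) * u (inverseBranch f O w' s)) := by
    intro s hs h
    rw [h, iterate_inverseBranch (hmemd s hs), inv_mul_cancel_left₀ (pow_ne_zero _ hz0)]
  refine ⟨f^[N] '' U, hF.isOpen_image_iterate ((hF.isOpen_cylinder _).inter
    (hF.isOpen_cylinder _)) hUsub, ⟨t, ⟨ht, fun k => hv k⟩, rfl⟩,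
    {s | s ∈ f^[N] '' U ∧ inverseBranch f O w' s ∈ G ∧ Complex.exp (Complex.I * b *
      birkhoffSum f τ N (inverseBranch f O w' s)) * u (inverseBranch f O w' s) =
      z ^ N * u (f^[N] (inverseBranch f O w' s))}, ?_, ?_, ?_⟩
  · filter_upwards [hF.ae_inverseBranch hUsub hae] with s hs hsU using ⟨hsU, hs hsU⟩
  · rintro s ⟨hs, hsG, hse⟩
    rw [hus s hs hse, norm_mul, norm_mul, norm_exp_I_mul, hG1 _ hsG, norm_inv, norm_pow, hz,
      one_pow, inv_one, one_mul, one_mul]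
  · refine LipschitzOnWith.of_dist_le_mul ?_
    rintro s ⟨hs, hsG, hse⟩ r ⟨hr, hrG, hre⟩
    rw [hus s hs hse, hus r hr hre, dist_eq_norm, ← mul_sub, norm_mul, norm_inv, norm_pow, hz,
      one_pow, inv_one, one_mul]
    set s' := inverseBranch f O w' s
    set r' := inverseBranch f O w' r
    have h1 : ‖u s' - u r'‖ ≤ K * |s - r| := by
      have h2 := hGL.dist_le_mul s' hsG r' hrG
      rw [dist_eq_norm] at h2
      refine h2.trans (mul_le_mul_of_nonneg_left ?_ K.2)
      refine (hF.abs_inverseBranch_sub_le (hmemd s hs) (hmemd r hr)).trans ?_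
      refine mul_le_of_le_one_left (abs_nonneg _) (Real.exp_le_one_iff.2 ?_)
      have := hF.rate_pos
      have : (0 : ℝ) ≤ N := Nat.cast_nonneg N
      nlinarith
    have h3 := (norm_exp_sub_exp_le b (birkhoffSum f τ N s') (birkhoffSum f τ N r')).trans
      (mul_le_mul_of_nonneg_left
        (hF.abs_birkhoffSum_inverseBranch_sub_le (hmemd s hs) (hmemd r hr)) (abs_nonneg b))
    -- Product rule: `K` comes from `u` and the contraction of the branch, and the second constant
    -- comes from `τ_N ∘ h`; neither depends on `N`.
    calc _ = ‖Complex.exp (Complex.I * b * birkhoffSum f τ N s') * (u s' - u r') +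
          (Complex.exp (Complex.I * b * birkhoffSum f τ N s') -
            Complex.exp (Complex.I * b * birkhoffSum f τ N r')) * u r'‖ := by
          congr 1; ring
      _ ≤ K * |s - r| + |b| * (hF.fibreConst * |s - r|) := by
          refine (norm_add_le _ _).trans ?_
          rw [norm_mul, norm_mul, norm_exp_I_mul, one_mul, hG1 _ hrG, mul_one]
          exact add_le_add h1 h3
      _ = _ := by
          rw [Real.dist_eq, NNReal.coe_add, NNReal.coe_mul, coe_nnnorm, Real.norm_eq_abs]
          ring

end Eigenfunction

end IsExpandingSkewProduct

end

/-! ### From the phase to a Lipschitz coboundary. -/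

theorem ae_of_locally {A : Set ℝ} {P : ℝ → Prop}
    (h : ∀ y ∈ A, ∃ U : Set ℝ, IsOpen U ∧ y ∈ U ∧ ∀ᵐ x, x ∈ U → P x) :
    ∀ᵐ x, x ∈ A → P x := by
  refine measure_null_of_locally_null _ fun y hy => ?_
  simp only [mem_compl_iff, mem_ofPred_eq, Classical.not_imp] at hy
  obtain ⟨U, hU, hyU, hP⟩ := h y hy.1
  refine ⟨_, inter_mem_nhdsWithin _ (hU.mem_nhds hyU), measure_mono_null ?_ hP⟩
  rintro x ⟨hx, hxU⟩
  simp only [mem_compl_iff, mem_ofPred_eq, Classical.not_imp] at hx ⊢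
  exact ⟨hxU, hx.2⟩

/-- Local Lipschitz representatives of a phase can be glued. -/
theorem exists_locallyLipschitz_phase (u : ℝ → ℂ) (K : ℝ≥0) :
    ∃ (K' : ℝ≥0) (v : ℝ → ℂ), ∀ y, (∃ U : Set ℝ, IsOpen U ∧ y ∈ U ∧ IsLipschitzPhaseOn u K U) →
      ∃ U : Set ℝ, IsOpen U ∧ y ∈ U ∧ LipschitzOnWith K' v U ∧
        (∀ᵐ x, x ∈ U → v x = u x ∧ ‖u x‖ = 1) := by
  classical
  have hloc : ∀ y, (∃ U : Set ℝ, IsOpen U ∧ y ∈ U ∧ IsLipschitzPhaseOn u K U) →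
      ∃ (U : Set ℝ) (w : ℝ → ℂ), IsOpen U ∧ y ∈ U ∧ IsLipschitzPhaseOn u K U ∧
        LipschitzWith (lipschitzExtensionConstant ℂ * K) w ∧
        ∀ᵐ x, x ∈ U → w x = u x ∧ ‖u x‖ = 1 := by
    rintro y ⟨U, hU, hyU, hL⟩
    obtain ⟨G, hG, hG1, hGL⟩ := id hL
    obtain ⟨w, hw, hwG⟩ := hGL.extend_finite_dimension
    refine ⟨U, w, hU, hyU, hL, hw, ?_⟩
    filter_upwards [hG] with x hx hxU using ⟨(hwG (hx hxU)).symm, hG1 x (hx hxU)⟩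
  choose! U w hU hyU hL hw hwu using hloc
  -- The representative is the diagonal of the chosen extensions `w x`. Two extensions agree almost
  -- everywhere on the open overlap of their neighbourhoods, hence everywhere there by continuity.
  refine ⟨lipschitzExtensionConstant ℂ * K, fun x => w x x, fun y hy => ⟨U y, hU y hy, hyU y hy, ?_⟩⟩
  have heq : ∀ x ∈ U y, w x x = w y x := by
    intro x hx
    have hx' : ∃ U : Set ℝ, IsOpen U ∧ x ∈ U ∧ IsLipschitzPhaseOn u K U :=
      ⟨U y, hU y hy, hx, hL y hy⟩
    have hopen := (hU x hx').inter (hU y hy)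
    refine Measure.eqOn_open_of_ae_eq (μ := volume) (f := w x) (g := w y) ?_ hopen
      (hw x hx').continuous.continuousOn (hw y hy).continuous.continuousOn ⟨hyU x hx', hx⟩
    rw [EventuallyEq, ae_restrict_iff' hopen.measurableSet]
    filter_upwards [hwu x hx', hwu y hy] with t h1 h2 ht
    rw [(h1 ht.1).1, (h2 ht.2).1]
  constructor
  · refine LipschitzOnWith.of_dist_le_mul fun s hs t ht => ?_
    rw [heq s hs, heq t ht]
    exact (hw y hy).dist_le_mul s t
  · filter_upwards [hwu y hy] with x hx hxU
    rw [heq x hxU]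
    exact hx hxU

section

variable {ι : Type*} {α : ℝ≥0} {f τ : ℝ → ℝ} {O : ι → Set ℝ}

/-- The derivative of the argument of `v` satisfies the differentiated cohomological equation. -/
theorem im_deriv_mul_conj_eq {z : ℂ} {v : ℝ → ℂ} {x f' τ' : ℝ} {b : ℝ} (hz : ‖z‖ = 1)
    (hf : HasDerivAt f f' x) (hτ : HasDerivAt τ τ' x) (hv : DifferentiableAt ℝ v x)
    (hvf : DifferentiableAt ℝ v (f x)) (hvx : ‖v x‖ = 1)
    (h : (fun t => z * v (f t)) =ᶠ[𝓝 x] fun t => Complex.exp (Complex.I * b * τ t) * v t) :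
    f' * (deriv v (f x) * (starRingEnd ℂ) (v (f x))).im =
      b * τ' + (deriv v x * (starRingEnd ℂ) (v x)).im := by
  have h1 : HasDerivAt (fun t => z * v (f t)) (z * (f' • deriv v (f x))) x :=
    (hvf.hasDerivAt.scomp x hf).const_mul z
  have h2 : HasDerivAt (fun t => Complex.exp (Complex.I * b * τ t) * v t)
      (Complex.exp (Complex.I * b * τ x) * (Complex.I * b * τ') * v x +
        Complex.exp (Complex.I * b * τ x) * deriv v x) x :=
    ((hτ.ofReal_comp.const_mul (Complex.I * b)).cexp).mul hv.hasDerivAt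
  have h3 := (h1.congr_of_eventuallyEq h.symm).unique h2
  have h4 := h.self_of_nhds
  simp only at h4
  have conj_self : ∀ w : ℂ, ‖w‖ = 1 → w * (starRingEnd ℂ) w = 1 := fun w hw => by
    rw [Complex.mul_conj, Complex.normSq_eq_norm_sq, hw]; norm_num
  have he := conj_self _ (norm_exp_I_mul b (τ x))
  set e := Complex.exp (Complex.I * b * τ x)
  have h5 : (f' : ℂ) * (deriv v (f x) * (starRingEnd ℂ) (v (f x))) =
      Complex.I * ((b * τ' : ℝ) : ℂ) + deriv v x * (starRingEnd ℂ) (v x) := by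
    -- Multiplying the differentiated equation by the conjugate of `z v(f x) = e v(x)` removes the
    -- unimodular factors.
    have h6 : (starRingEnd ℂ) z * (starRingEnd ℂ) (v (f x)) =
        (starRingEnd ℂ) e * (starRingEnd ℂ) (v x) := by
      rw [← map_mul, ← map_mul, h4]
    rw [Complex.real_smul] at h3
    push_cast
    linear_combination (-(f' : ℂ) * deriv v (f x) * (starRingEnd ℂ) (v (f x))) * conj_self z hz +
      ((starRingEnd ℂ) z * (starRingEnd ℂ) (v (f x))) * h3 +
      (e * (Complex.I * b * τ') * v x + e * deriv v x) * h6 +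
      (Complex.I * b * τ' * (v x * (starRingEnd ℂ) (v x)) +
        deriv v x * (starRingEnd ℂ) (v x)) * he + Complex.I * b * τ' * conj_self _ hvx
  have h7 := congrArg Complex.im h5
  rwa [Complex.im_ofReal_mul, Complex.add_im, Complex.I_mul_im, Complex.ofReal_re] at h7

namespace IsExpandingSkewProduct

/-- A derivative vanishing almost everywhere forces constancy only with absolute continuity; on
compact subintervals of `O i` this follows from the `C¹` regularity of `f` and `τ`. -/
theorem eqOn_const_of_ae_hasDerivAt (hF : IsExpandingSkewProduct α f τ O) {φ : ℝ → ℝ} {K : ℝ≥0}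
    (hφ : LipschitzWith K φ) (i : ι)
    (h : ∀ᵐ x, x ∈ O i → HasDerivAt (τ - φ ∘ f + φ) 0 x) :
    ∃ c : ℝ, ∀ x ∈ O i, τ x = φ (f x) - φ x + c := by
  obtain ⟨a, c, -, hac, -, hO⟩ := hF.interval i
  obtain ⟨x₀, hx₀⟩ : (O i).Nonempty := by rw [hO]; exact nonempty_Ioo.2 hac
  refine ⟨(τ - φ ∘ f + φ) x₀, fun x hx => ?_⟩
  have hsub : uIcc x₀ x ⊆ O i := (hF.ordConnected i).uIcc_subset hx₀ hx
  have hconv : Convex ℝ (uIcc x₀ x) := convex_uIcc _ _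
  obtain ⟨K₁, hK₁⟩ := ((hF.contDiffOn_fibre i).mono hsub).exists_lipschitzOnWith one_ne_zero
    hconv isCompact_uIcc
  obtain ⟨K₂, hK₂⟩ := ((hF.contDiffOn i).mono hsub).exists_lipschitzOnWith one_ne_zero
    hconv isCompact_uIcc
  have hac : AbsolutelyContinuousOnInterval (τ - φ ∘ f + φ) x₀ x :=
    (hK₁.absolutelyContinuousOnInterval.sub
      (hφ.comp_lipschitzOnWith hK₂).absolutelyContinuousOnInterval).add
      (hφ.lipschitzOnWith (s := uIcc x₀ x)).absolutelyContinuousOnInterval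
  obtain ⟨C, hC⟩ := hac.const_of_ae_hasDerivAt_zero (h.mono fun t ht htx => ht (hsub htx))
  have h1 := (hC x right_mem_uIcc).trans (hC x₀ left_mem_uIcc).symm
  rw [← h1]
  simp only [Pi.add_apply, Pi.sub_apply, Function.comp_apply]
  ring

/-- If `u` is a locally Lipschitz phase almost everywhere and satisfies the multiplicative
cohomological equation, then `τ` is Lipschitz-cohomologous to a piecewise constant function. -/
theorem exists_cohomologous [Countable ι] (hF : IsExpandingSkewProduct α f τ O) {b : ℝ}
    (hb : b ≠ 0) {z : ℂ} (hz : ‖z‖ = 1) {u : ℝ → ℂ} (hu : Measurable u) (hu1 : ∀ x, ‖u x‖ ≤ 1)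
    (heq : ∀ᵐ x ∂circleMeasure, u x ≠ 0 →
      Complex.exp (Complex.I * b * τ x) * u x = z * u (f x)) {K : ℝ≥0}
    (hK : ∀ᵐ y ∂circleMeasure, ∃ U : Set ℝ, IsOpen U ∧ y ∈ U ∧ IsLipschitzPhaseOn u K U) :
    ∃ φ : ℝ → ℝ, (∃ K : ℝ≥0, LipschitzOnWith K φ (Ico 0 1)) ∧
      ∀ i, ∃ c : ℝ, ∀ x ∈ O i, τ x = φ (f x) - φ x + c := by
  obtain ⟨K', v, hv⟩ := exists_locallyLipschitz_phase u K
  set A : Set ℝ := {y | ∃ U : Set ℝ, IsOpen U ∧ y ∈ U ∧ IsLipschitzPhaseOn u K U} with hA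
  have hAo : IsOpen A := isOpen_iff_mem_nhds.2 fun y ⟨U, hU, hyU, hL⟩ =>
    mem_of_superset (hU.mem_nhds hyU) fun x hx => ⟨U, hU, hx, hL⟩
  have hvu : ∀ᵐ x, x ∈ A → v x = u x ∧ ‖u x‖ = 1 := ae_of_locally fun y hy => by
    obtain ⟨U, hU, hyU, -, h⟩ := hv y hy
    exact ⟨U, hU, hyU, h⟩
  have hvd : ∀ᵐ x, x ∈ A → DifferentiableAt ℝ v x := ae_of_locally fun y hy => by
    obtain ⟨U, hU, hyU, hL, -⟩ := hv y hy
    refine ⟨U, hU, hyU, ?_⟩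
    filter_upwards [hL.ae_differentiableWithinAt_of_mem (μ := volume)] with x hx hxU
      using (hx hxU).differentiableAt (hU.mem_nhds hxU)
  -- This is the derivative of the argument of `u`, obtained without choosing a logarithm. It is
  -- bounded, so its integral is globally Lipschitz even if the phase itself jumps across the null
  -- set missed by `A`.
  set ω : ℝ → ℝ := A.indicator fun y => (deriv v y * (starRingEnd ℂ) (u y)).im with hω
  have hωm : Measurable ω :=
    (Complex.measurable_im.comp ((measurable_deriv v).mul
      (Complex.continuous_conj.measurable.comp hu))).indicator hAo.measurableSet
  have hωK : ∀ y, ‖ω y‖ ≤ K' := by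
    intro y
    by_cases hy : y ∈ A
    · obtain ⟨U, hU, hyU, hL, -⟩ := hv y hy
      rw [hω, indicator_of_mem hy]
      refine (Complex.abs_im_le_norm _).trans ?_
      rw [norm_mul, Complex.norm_conj]
      have := norm_deriv_le_of_lipschitzOn (hU.mem_nhds hyU) hL
      exact (mul_le_of_le_one_right (norm_nonneg _) (hu1 y)).trans this
    · rw [hω, indicator_of_notMem hy, norm_zero]
      exact K'.2
  have hωi : LocallyIntegrable ω volume := by
    refine (locallyIntegrable_const (K' : ℝ)).mono hωm.aestronglyMeasurable
      (Eventually.of_forall fun y => ?_)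
    exact (hωK y).trans (Real.le_norm_self _)
  have hωii : ∀ s t, IntervalIntegrable ω volume s t := fun s t =>
    intervalIntegrable_iff.2 ((hωi.integrableOn_isCompact isCompact_uIcc).mono_set
      uIoc_subset_uIcc)
  set φ : ℝ → ℝ := fun x => b⁻¹ * ∫ t in (0 : ℝ)..x, ω t with hφ
  have hφL : LipschitzWith (‖b⁻¹‖₊ * K') φ := LipschitzWith.of_dist_le_mul fun x y => by
    rw [dist_eq_norm, hφ]
    simp only
    rw [← mul_sub, intervalIntegral.integral_interval_sub_left (hωii _ _) (hωii _ _), norm_mul, NNReal.coe_mul, coe_nnnorm, mul_assoc, Real.dist_eq]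
    gcongr
    exact intervalIntegral.norm_integral_le_of_norm_le_const fun t _ => hωK t
  have hφd : ∀ᵐ x, HasDerivAt φ (b⁻¹ * ω x) x := by
    filter_upwards [_root_.LocallyIntegrable.ae_hasDerivAt_integral hωi] with x hx using (hx 0).const_mul _
  refine ⟨φ, ⟨_, hφL.lipschitzOnWith⟩, fun i => hF.eqOn_const_of_ae_hasDerivAt hφL i ?_⟩
  have hQ : ∀ᵐ x ∂circleMeasure, x ∈ A ∧ v x = u x ∧ ‖u x‖ = 1 ∧ DifferentiableAt ℝ v x ∧
      HasDerivAt φ (b⁻¹ * ω x) x := by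
    filter_upwards [hK, ae_restrict_of_ae hvu, ae_restrict_of_ae hvd, ae_restrict_of_ae hφd]
      with x h1 h2 h3 h4
    exact ⟨h1, (h2 h1).1, (h2 h1).2, h3 h1, h4⟩
  have hQf := hF.ae_comp hQ
  rw [ae_circleMeasure_iff] at hQ hQf heq
  have hvf : ∀ᵐ t, t ∈ O i → z * v (f t) = Complex.exp (Complex.I * b * τ t) * v t := by
    filter_upwards [hQ, hQf, heq] with t h1 h2 h3 ht
    have htI := hF.subset_Ico i ht
    obtain ⟨-, h1v, h1n, -⟩ := h1 htI
    rw [(h2 htI).2.1, h1v, h3 htI (fun h0 => by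
      rw [h0, norm_zero] at h1n; exact zero_ne_one h1n)]
  filter_upwards [hQ, hQf] with x h1 h2 hx
  obtain ⟨hxA, hxv, hxn, hxd, hxφ⟩ := h1 (hF.subset_Ico i hx)
  obtain ⟨hfA, hfv, -, hfd, hfφ⟩ := h2 (hF.subset_Ico i hx)
  have hf' := ((hF.contDiffAt hx).differentiableAt one_ne_zero).hasDerivAt
  have hτ' := ((hF.contDiffAt_fibre hx).differentiableAt one_ne_zero).hasDerivAt
  obtain ⟨U, hU, hxU, hUL, -⟩ := hv x hxA
  obtain ⟨U', hU', hxU', hUL', -⟩ := hv (f x) hfA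
  have hfc : ContinuousOn f (O i) := (hF.contDiffOn i).continuousOn
  have hWo : IsOpen ((O i ∩ f ⁻¹' U') ∩ U) :=
    (hfc.isOpen_inter_preimage (hF.isOpen i) hU').inter hU
  -- Continuity upgrades the almost everywhere equation to a neighbourhood of `x`, so that it can be
  -- differentiated.
  have hEq : (fun t => z * v (f t)) =ᶠ[𝓝 x]
      fun t => Complex.exp (Complex.I * b * τ t) * v t := by
    refine eventuallyEq_of_mem (hWo.mem_nhds ⟨⟨hx, hxU'⟩, hxU⟩)
      (Measure.eqOn_open_of_ae_eq (μ := volume) ?_ hWo ?_ ?_)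
    · rw [EventuallyEq, ae_restrict_iff' hWo.measurableSet]
      filter_upwards [hvf] with t ht htW using ht htW.1.1
    · exact continuousOn_const.mul (hUL'.continuousOn.comp (hfc.mono fun t ht => ht.1.1)
        fun t ht => ht.1.2)
    · refine ContinuousOn.mul ?_ (hUL.continuousOn.mono fun t ht => ht.2)
      refine Complex.continuous_exp.comp_continuousOn (continuousOn_const.mul ?_)
      exact Complex.continuous_ofReal.comp_continuousOn
        ((hF.contDiffOn_fibre i).continuousOn.mono fun t ht => ht.1.1)
  have hkey := im_deriv_mul_conj_eq (x := x) hz hf' hτ' hxd hfd (by rw [hxv, hxn]) hEq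
  have hωx : ω x = (deriv v x * (starRingEnd ℂ) (v x)).im := by
    rw [hω, indicator_of_mem hxA, hxv]
  have hωf : ω (f x) = (deriv v (f x) * (starRingEnd ℂ) (v (f x))).im := by
    rw [hω, indicator_of_mem hfA, hfv]
  rw [← hωx, ← hωf] at hkey
  have hd := (hτ'.sub (hfφ.comp x hf')).add hxφ
  refine hd.congr_deriv ?_
  field_simp
  linear_combination -hkey

end IsExpandingSkewProduct

/-- The twisted transfer operators have no eigenvalue of modulus one on an adapted space. -/
theorem IsTransferOn.eq_zero_of_eigenvector [Countable ι] (hα : 0 < α)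
    (hF : IsExpandingSkewProduct α f τ O) {B : Type*} [NormedAddCommGroup B] [NormedSpace ℂ B]
    {J : B →ₗ[ℂ] Lp ℂ 1 circleMeasure} (hB : IsAdapted α J) {b : ℝ} (hb : b ≠ 0)
    {L : B →L[ℂ] B} (hL : IsTransferOn f τ O b J L) {z : ℂ} (hz : ‖z‖ = 1) {p : B}
    (hp : L p = z • p) : p = 0 := by
  by_contra hp0
  have hg : Measurable (J p) := (Lp.stronglyMeasurable (J p)).measurable
  have hgi : ∫⁻ x, ‖J p x‖ₑ ∂circleMeasure ≠ ⊤ := by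
    rw [← eLpNorm_one_eq_lintegral_enorm]
    exact (Lp.eLpNorm_lt_top (J p)).ne
  have hg0 : ∫⁻ x, ‖J p x‖ₑ ∂circleMeasure ≠ 0 := by
    rw [← eLpNorm_one_eq_lintegral_enorm]
    intro h0
    rw [eLpNorm_eq_zero_iff (Lp.aestronglyMeasurable _) one_ne_zero] at h0
    refine hp0 (hB.injective ?_)
    rw [map_zero]
    exact (Lp.eq_zero_iff_ae_eq_zero).2 h0
  have htr : transfer f τ O b (J p) =ᵐ[circleMeasure] fun x => z * J p x := by
    have h1 := hL p
    rw [hp, map_smul] at h1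
    filter_upwards [h1, Lp.coeFn_smul z (J p)] with x h2 h3
    rw [← h2, h3]
    rfl
  have hu := measurable_phase hg
  have hu1 := norm_phase_le (J p)
  have heq := hF.ae_phase_iterate_eq hz hg hgi htr
  obtain ⟨ρ, hρ, hfreq⟩ := hF.exists_frequently_mem_goodSet hz hα hB hg hgi hg0 htr
  have hui : LocallyIntegrable (phase (J p)) volume := by
    refine (locallyIntegrable_const (1 : ℝ)).mono hu.aestronglyMeasurable
      (Eventually.of_forall fun y => ?_)
    rw [norm_one]
    exact hu1 y
  -- Almost every point for `|g| m` is a Lebesgue point with nonzero phase, so one of them is also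
  -- good infinitely often.
  have hν : ∀ᵐ x ∂massMeasure (J p), x ∈ Ico (0 : ℝ) 1 ∧ J p x ≠ 0 ∧
      Tendsto (fun δ => ⨍ y in Metric.closedBall x δ, ‖phase (J p) y - phase (J p) x‖)
        (𝓝[>] 0) (𝓝 0) := by
    rw [massMeasure, ae_withDensity_iff hg.enorm]
    filter_upwards [ae_restrict_mem measurableSet_Ico, ae_restrict_of_ae
      (IsUnifLocDoublingMeasure.ae_tendsto_average_norm_sub volume hui 1)] with x h1 h2 h3
    refine ⟨h1, enorm_ne_zero.1 h3, h2 (fun _ => x) id tendsto_id ?_⟩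
    filter_upwards [self_mem_nhdsWithin] with δ hδ
    exact Metric.mem_closedBall_self (by simpa using (mem_Ioi.1 hδ).le)
  obtain ⟨x, hxg, hx, hx0, hleb⟩ := (hfreq.and_eventually hν).exists
  obtain ⟨V, hV, hVne, hV1, hVL⟩ := hF.exists_isLipschitzPhaseOn hz hu hu1
    (fun _ => norm_phase) heq hρ hx (phase_ne_zero hx0) hxg hleb
  exact hF.not_cohomologous (hF.exists_cohomologous hb hz hu hu1
    (hF.ae_phase_eq hz hg hgi htr) (hF.ae_exists_isLipschitzPhaseOn hz heq hV hVne hV1 hVL))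

end

end SkewProduct

end

theorem mainTheorem3 {ι : Type*} [Countable ι] (α : ℝ≥0) (hα : 0 < α) (hα1 : α ≤ 1)
    (f τ : ℝ → ℝ) (O : ι → Set ℝ) (hF : SkewProduct.IsExpandingSkewProduct α f τ O)
    {B : Type*} [NormedAddCommGroup B] [NormedSpace ℂ B] [CompleteSpace B]
    (J : B →ₗ[ℂ] Lp ℂ 1 SkewProduct.circleMeasure) (hB : SkewProduct.IsAdapted α J)
    (μ : Measure ℝ) (hμ : SkewProduct.IsMixingInvariant f J μ) :
    ∀ b : ℝ, b ≠ 0 → ∀ L : B →L[ℂ] B, SkewProduct.IsTransferOn f τ O b J L →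
      spectralRadius ℂ L ≤ 1 → SkewProduct.essentialSpectralRadius L < 1 →
      ∃ C r : ℝ, 0 < r ∧ ∀ n : ℕ, ‖L ^ n‖ ≤ C * Real.exp (-r * n) := by
  intro b hb L hL h1 hess
  refine (SkewProduct.exists_decay_or_exists_eigenvector h1 hess).resolve_right ?_
  rintro ⟨z, hz, p, hp, hLp⟩
  exact hp (hL.eq_zero_of_eigenvector hα hF hB hb hz hLp)
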